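/- Let $(X(k))_{k\ge 1}$ be a sequence of independent standard complex Gaussian random variables, i.e. the real and imaginary parts of each $X(k)$ are independent real Gaussians with mean $0$ and variance $\tfrac12$. For a real number $K\ge 1$ put $$F_K(z)=\exp\Big(\sum_{1\le k\le K}\frac{X(k)}{\sqrt k}\,z^k\Big).$$ There is an absolute constant $C>0$ such that for all real $K\ge 1$, all $q$ with $\tfrac12\le q\le 1$ and all $r$ with $1\le r\le e^{1/K}$, $$\mathbb{E}\Big[\Big(\frac1{2\pi}\int_0^{2\pi}|F_K(re^{i\theta})|^2\,d\theta\Big)^q\Big]\le C\Big(\frac{K}{(1-q)\sqrt{\log K}+1}\Big)^q .$$ -/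

import Mathlib

open MeasureTheory ProbabilityTheory

/-- The law of a standard complex Gaussian: real and imaginary parts are independent real Gaussians
with mean `0` and variance `1/2`. -/
noncomputable def stdComplexGaussian : Measure ℂ :=
  ((gaussianReal 0 (1 / 2)).prod (gaussianReal 0 (1 / 2))).map
    (fun p : ℝ × ℝ => (⟨p.1, p.2⟩ : ℂ))

/-- `(X k)` for `k ≥ 1` is a sequence of independent standard complex Gaussians on `(Ω, μ)`.
Nothing is required of the value `X 0`, which plays no role. -/
structure IsStdComplexGaussianSeq {Ω : Type*} [MeasurableSpace Ω] (X : ℕ → Ω → ℂ)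
    (μ : Measure Ω) : Prop where
  hasLaw : ∀ k : ℕ, 1 ≤ k → HasLaw (X k) stdComplexGaussian μ
  indep : iIndepFun (fun k : ℕ+ => X (k : ℕ)) μ

/-- For a real number `K` and coefficients `x 1, x 2, …`, the function
`F_K(z) = exp (∑_{1 ≤ k ≤ K} x(k) z ^ k / √k)`. -/
noncomputable def genF (x : ℕ → ℂ) (K : ℝ) (z : ℂ) : ℂ :=
  Complex.exp (∑ k ∈ Finset.Icc 1 ⌊K⌋₊, x k / (Real.sqrt k : ℂ) * z ^ k)

/-- The mean square `(1 / 2π) ∫_0^{2π} |F_K(r e^{iθ})|² dθ` on the circle of radius `r`. -/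
noncomputable def meanSq (x : ℕ → ℂ) (K r : ℝ) : ℝ :=
  1 / (2 * Real.pi) *
    ∫ θ in (0 : ℝ)..(2 * Real.pi), ‖genF x K ((r : ℂ) * Complex.exp (Complex.I * (θ : ℂ)))‖ ^ 2

/-! Fix a point `z` with `‖z‖ = r`. Then `‖F_K(z)‖² = exp(2S)`, where `S` is a sum of independent
centred Gaussians whose variance over each dyadic block of indices lies between two positive
constants. So `log ‖F‖`, observed at the scales `2 ^ n`, is a Gaussian walk with about `log K`
steps. Write `M` for the mean square. Its mean is `O(K)`, and Jensen's inequality settles the case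
`(1 - q)√(log K) ≤ 1`.

The saving in the other case comes from a barrier. Weighting by `exp(2S)` gives the walk a drift of
at least `n log 2` at scale `2 ^ n`, and this is the level allowed by `‖F_{2^n}(z)‖² ≤ T 4^n (n +
1)²`. Imposing this bound at every dyadic scale therefore multiplies the second moment by at most
the probability that a centred walk stays below `(log T)/2 + log m`. The ballot estimate
`exists_survival_le` makes this `O((log T + 1)/√(log K))`; see
`exists_setLIntegral_norm_genF_sq_le`.

The barrier holds at all points of the circle at once, because Cauchy's formula for `F²` bounds
point values by mean squares on a larger circle. One variable `W`, the `scaleSum`, of bounded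
expectation controls every scale, and on `W ≤ e^j` one may take `T = e^(2+j)`. Hence `E[M; W ≤ e^j]
= O(K (j + 1)/√(log K))`. Averaging over `j` with geometric weights and applying Hölder's inequality
(`lintegral_rpow_le_of_setLIntegral_le`) bounds the moment of order `q`.

The ballot estimate compares two bounds for the mean distance to the barrier on survival. Harris'
inequality makes it at least a constant times `√m` times the survival probability. Optional stopping
with bounded overshoot makes it at most the initial height, a constant, and a sum that a bootstrap
shows to be bounded. -/

open scoped NNReal ENNReal

/-! ### Killed Gaussian walks and correlation inequalities -/

/-- The law at time `m` of a Gaussian random walk started at `0` with step variances `v i`, killed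
when it exceeds the barrier `b i` at some time `1 ≤ i ≤ m`. -/
noncomputable def killedWalk (v : ℕ → ℝ≥0) (b : ℕ → ℝ) : ℕ → Measure ℝ
  | 0 => Measure.dirac 0
  | m + 1 => ((killedWalk v b m).conv (gaussianReal 0 (v m))).restrict (Set.Iic (b (m + 1)))

theorem killedWalk_succ (v : ℕ → ℝ≥0) (b : ℕ → ℝ) (m : ℕ) :
    killedWalk v b (m + 1) =
      ((killedWalk v b m).conv (gaussianReal 0 (v m))).restrict (Set.Iic (b (m + 1))) := rfl

instance isFiniteMeasure_killedWalk (v : ℕ → ℝ≥0) (b : ℕ → ℝ) (m : ℕ) :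
    IsFiniteMeasure (killedWalk v b m) := by
  induction m with
  | zero => unfold killedWalk; infer_instance
  | succ m ih => rw [killedWalk_succ]; infer_instance

/-- Chebyshev's association inequality: `(f x - f y) * (g x - g y)` is nonnegative for functions
monotone in the same sense, and one integrates it over two independent copies of the variable. -/
theorem integral_mul_integral_le_of_antitone {γ : Measure ℝ} [IsProbabilityMeasure γ]
    {f g : ℝ → ℝ} (hf : Antitone f) (hg : Antitone g) (hf' : ∀ x, f x ∈ Set.Icc (0 : ℝ) 1)
    (hg' : ∀ x, g x ∈ Set.Icc (0 : ℝ) 1) :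
    (∫ x, f x ∂γ) * (∫ x, g x ∂γ) ≤ ∫ x, f x * g x ∂γ := by
  have hfi : Integrable f γ := Integrable.of_mem_Icc 0 1 hf.measurable.aemeasurable (.of_forall hf')
  have hgi : Integrable g γ := Integrable.of_mem_Icc 0 1 hg.measurable.aemeasurable (.of_forall hg')
  have hfg : Integrable (fun x => f x * g x) γ :=
    Integrable.of_mem_Icc 0 1 (hf.measurable.mul hg.measurable).aemeasurable
      (.of_forall fun x => ⟨mul_nonneg (hf' x).1 (hg' x).1,
        mul_le_one₀ (hf' x).2 (hg' x).1 (hg' x).2⟩)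
  have key (x : ℝ) : 0 ≤ f x * g x - f x * (∫ y, g y ∂γ) - g x * (∫ y, f y ∂γ) +
      ∫ y, f y * g y ∂γ := by
    have h : ∫ y, (f x - f y) * (g x - g y) ∂γ = f x * g x - f x * (∫ y, g y ∂γ) -
        g x * (∫ y, f y ∂γ) + ∫ y, f y * g y ∂γ := by
      have : (fun y => (f x - f y) * (g x - g y)) =
          fun y => f x * g x - f x * g y - g x * f y + f y * g y := by ext y; ring
      rw [this, integral_add (by fun_prop) hfg, integral_sub (by fun_prop) (by fun_prop),
        integral_sub (by fun_prop) (by fun_prop), integral_const_mul, integral_const_mul]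
      simp [integral_const_mul]
    rw [← h]
    refine integral_nonneg fun y => ?_
    rcases le_total x y with hxy | hxy
    · exact mul_nonneg (sub_nonneg.2 (hf hxy)) (sub_nonneg.2 (hg hxy))
    · exact mul_nonneg_of_nonpos_of_nonpos (sub_nonpos.2 (hf hxy)) (sub_nonpos.2 (hg hxy))
  have h2 := integral_nonneg (μ := γ) (f := fun x => f x * g x - f x * (∫ y, g y ∂γ) -
    g x * (∫ y, f y ∂γ) + ∫ y, f y * g y ∂γ) key
  rw [integral_add (by fun_prop) (by fun_prop), integral_sub (by fun_prop) (by fun_prop),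
    integral_sub hfg (by fun_prop), integral_mul_const, integral_mul_const] at h2
  simp at h2
  linarith [mul_comm (∫ x, g x ∂γ) (∫ x, f x ∂γ)]

theorem antitone_integral_add {γ : Measure ℝ} [IsProbabilityMeasure γ] {f : ℝ → ℝ}
    (hf : Antitone f) (hf' : ∀ x, f x ∈ Set.Icc (0 : ℝ) 1) :
    Antitone (fun x => ∫ y, f (x + y) ∂γ) ∧ ∀ x, ∫ y, f (x + y) ∂γ ∈ Set.Icc (0 : ℝ) 1 := by
  have hi (x : ℝ) : Integrable (fun y => f (x + y)) γ :=
    Integrable.of_mem_Icc 0 1 (hf.measurable.comp (measurable_const_add x)).aemeasurable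
      (.of_forall fun y => hf' _)
  refine ⟨fun x x' h => integral_mono (hi _) (hi _) fun y => hf (by gcongr), fun x =>
    ⟨integral_nonneg fun y => (hf' _).1, ?_⟩⟩
  calc ∫ y, f (x + y) ∂γ ≤ ∫ y, (1 : ℝ) ∂γ :=
        integral_mono (hi x) (by fun_prop) fun y => (hf' _).2
    _ = 1 := by simp

theorem integrable_of_antitone_of_mem_Icc {γ : Measure ℝ} [IsFiniteMeasure γ] {f : ℝ → ℝ}
    (hf : Antitone f) (hf' : ∀ x, f x ∈ Set.Icc (0 : ℝ) 1) : Integrable f γ :=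
  Integrable.of_mem_Icc 0 1 hf.measurable.aemeasurable (.of_forall hf')

/-- Harris' inequality for the killed walk. -/
theorem integral_mul_integral_killedWalk_le (v : ℕ → ℝ≥0) (b : ℕ → ℝ) (m : ℕ) :
    ∀ φ ψ : ℝ → ℝ, Antitone φ → Antitone ψ → (∀ x, φ x ∈ Set.Icc (0 : ℝ) 1) →
      (∀ x, ψ x ∈ Set.Icc (0 : ℝ) 1) →
      (∫ x, φ x ∂(gaussianReal 0 (∑ i ∈ Finset.range m, v i))) * (∫ x, ψ x ∂(killedWalk v b m)) ≤
        ∫ x, φ x * ψ x ∂(killedWalk v b m) := by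
  induction m with
  | zero => intro φ ψ _ _ _ _; simp [killedWalk]
  | succ m ih =>
    intro φ ψ hφ hψ hφ' hψ'
    set γ := gaussianReal 0 (v m)
    -- The killing at the last step is absorbed into `ψ`. Antitonicity survives because `Set.Iic` is
    -- a lower set and `ψ ≥ 0`.
    set χ := (Set.Iic (b (m + 1))).indicator ψ with hχd
    have hχ : Antitone χ := by
      intro x y hxy
      simp only [hχd, Set.indicator_apply, Set.mem_Iic]
      split_ifs with h1 h2
      · exact hψ hxy
      · exact absurd (hxy.trans h1) h2
      · exact (hψ' x).1
      · exact le_rfl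
    have hχ' : ∀ x, χ x ∈ Set.Icc (0 : ℝ) 1 := by
      intro x
      simp only [hχd, Set.indicator_apply]
      split_ifs
      · exact hψ' x
      · simp
    have hφχ : Antitone (fun x => φ x * χ x) := fun x y h =>
      mul_le_mul (hφ h) (hχ h) (hχ' _).1 (hφ' _).1
    have hφχ' : ∀ x, φ x * χ x ∈ Set.Icc (0 : ℝ) 1 := fun x =>
      ⟨mul_nonneg (hφ' x).1 (hχ' x).1, mul_le_one₀ (hφ' x).2 (hχ' x).1 (hχ' x).2⟩
    have e1 : ∫ x, ψ x ∂(killedWalk v b (m + 1)) =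
        ∫ x, ∫ y, χ (x + y) ∂γ ∂(killedWalk v b m) := by
      rw [killedWalk_succ, ← integral_indicator measurableSet_Iic,
        integral_conv (integrable_of_antitone_of_mem_Icc hχ hχ')]
    have e2 : ∫ x, φ x * ψ x ∂(killedWalk v b (m + 1)) =
        ∫ x, ∫ y, φ (x + y) * χ (x + y) ∂γ ∂(killedWalk v b m) := by
      rw [killedWalk_succ, ← integral_indicator measurableSet_Iic]
      have : (Set.Iic (b (m + 1))).indicator (fun x => φ x * ψ x) = fun x => φ x * χ x := by
        ext x; simp [hχd, Set.indicator_apply]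
      rw [this, integral_conv (integrable_of_antitone_of_mem_Icc hφχ hφχ')]
    have e3 : ∫ x, φ x ∂(gaussianReal 0 (∑ i ∈ Finset.range (m + 1), v i)) =
        ∫ x, ∫ y, φ (x + y) ∂γ ∂(gaussianReal 0 (∑ i ∈ Finset.range m, v i)) := by
      rw [Finset.sum_range_succ, ← integral_conv (integrable_of_antitone_of_mem_Icc hφ hφ'),
        gaussianReal_conv_gaussianReal, add_zero]
    obtain ⟨hΦ, hΦ'⟩ := antitone_integral_add (γ := γ) hφ hφ'
    obtain ⟨hΨ, hΨ'⟩ := antitone_integral_add (γ := γ) hχ hχ'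
    obtain ⟨hΞ, hΞ'⟩ := antitone_integral_add (γ := γ) hφχ hφχ'
    rw [e1, e2, e3]
    -- The induction hypothesis decouples the functions averaged over the last step; Chebyshev's
    -- inequality in that step alone then recombines them.
    refine (ih _ _ hΦ hΨ hΦ' hΨ').trans (integral_mono ?_
      (integrable_of_antitone_of_mem_Icc hΞ hΞ') fun x => ?_)
    · exact integrable_of_antitone_of_mem_Icc (fun x y h =>
        mul_le_mul (hΦ h) (hΨ h) (hΨ' _).1 (hΦ' _).1) fun x =>
        ⟨mul_nonneg (hΦ' x).1 (hΨ' x).1, mul_le_one₀ (hΦ' x).2 (hΨ' x).1 (hΨ' x).2⟩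
    · exact integral_mul_integral_le_of_antitone (fun y z h => hφ (by gcongr))
        (fun y z h => hχ (by gcongr)) (fun _ => hφ' _) (fun _ => hχ' _)

/-! ### Overshoot and optional stopping -/

theorem integrable_abs_gaussianReal (v : ℝ≥0) : Integrable (fun x => |x|) (gaussianReal 0 v) :=
  ((memLp_id_gaussianReal (μ := 0) (v := v) 1).integrable le_rfl).abs

theorem integrable_id_gaussianReal (v : ℝ≥0) : Integrable (fun x => x) (gaussianReal 0 v) :=
  (memLp_id_gaussianReal (μ := 0) (v := v) 1).integrable le_rfl

theorem integral_abs_gaussianReal_le (v : ℝ≥0) :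
    ∫ x, |x| ∂(gaussianReal 0 v) ≤ (1 + v) / 2 := by
  have h2 : Integrable (fun x => x ^ 2) (gaussianReal 0 v) :=
    (memLp_id_gaussianReal (μ := 0) (v := v) 2).integrable_sq
  have hv : ∫ x, x ^ 2 ∂(gaussianReal 0 v) = v := by
    have := variance_fun_id_gaussianReal (μ := 0) (v := v)
    rw [variance_eq_integral (by fun_prop)] at this
    simpa using this
  calc ∫ x, |x| ∂(gaussianReal 0 v) ≤ ∫ x, (1 + x ^ 2) / 2 ∂(gaussianReal 0 v) := by
        refine integral_mono (integrable_abs_gaussianReal v) (by fun_prop) fun x => ?_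
        have := sq_nonneg (|x| - 1)
        simp only
        nlinarith [sq_abs x]
    _ = (1 + v) / 2 := by
        rw [integral_div, integral_add (by fun_prop) h2, hv]; simp

/-- The mean overshoot of a centred Gaussian step above a nonnegative level is bounded. -/
theorem setIntegral_Ioi_sub_gaussianReal_nonpos {v : ℝ≥0} {C y : ℝ} (hC : (1 + v) / 2 ≤ C)
    (hy : 0 ≤ y) : ∫ t in Set.Ioi y, (t - y - C) ∂(gaussianReal 0 v) ≤ 0 := by
  by_cases hv : v = 0
  · subst hv
    simp [gaussianReal_zero_var, restrict_dirac, hy.not_gt]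
  have hv0 : (0 : ℝ) < v := by positivity
  set p := gaussianPDFReal 0 v
  have hp (f : ℝ → ℝ) (s : Set ℝ) (hs : MeasurableSet s) :
      ∫ t in s, f t ∂(gaussianReal 0 v) = ∫ t in s, f t * p t := by
    rw [← integral_indicator hs, integral_gaussianReal_eq_integral_smul hv,
      ← integral_indicator hs]
    congr 1 with t
    by_cases ht : t ∈ s <;> simp [ht, p, mul_comm]
  have hpi (f : ℝ → ℝ) (hf : Integrable f (gaussianReal 0 v)) : Integrable (fun t => f t * p t) := by
    rw [gaussianReal_of_var_ne_zero _ hv, integrable_withDensity_iff_integrable_smul₀'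
      (measurable_gaussianPDF 0 v).aemeasurable (.of_forall fun x => gaussianPDF_lt_top)] at hf
    refine hf.congr (.of_forall fun t => ?_)
    simp [p, toReal_gaussianPDF, mul_comm]
  -- The density ratio `p (s + y) / p s` decreases in `s` when `y ≥ 0`, so raising the level only
  -- favours smaller overshoots. This reduces the claim to level `0`, where symmetry and the bound
  -- on the mean of `|x|` suffice.
  set w : ℝ → ℝ := fun s => Real.exp (-(2 * s * y + y ^ 2) / (2 * v)) with hw
  have hwp (s : ℝ) : p (s + y) = p s * w s := by
    simp only [p, gaussianPDFReal, hw, mul_assoc, ← Real.exp_add]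
    congr 2
    field_simp
    ring
  have hwa : Antitone w := fun s t h => by
    simp only [hw]
    gcongr
  rw [hp _ _ measurableSet_Ioi]
  have hshift : ∫ t in Set.Ioi y, (t - y - C) * p t = ∫ s in Set.Ioi 0, (s - C) * p (s + y) := by
    have := (measurePreserving_add_right (volume : Measure ℝ) y).setIntegral_preimage_emb
      (measurableEmbedding_addRight y) (fun t => (t - y - C) * p t) (Set.Ioi y)
    rw [← this]
    simp
  have hint : Integrable (fun s => (s - C) * p s) :=
    hpi _ ((integrable_id_gaussianReal v).sub (integrable_const C))
  have hint2 : Integrable (fun s => (s - C) * p (s + y)) := by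
    have := (hpi _ ((integrable_id_gaussianReal v).sub (integrable_const (y + C)))).comp_add_right y
    refine this.congr (.of_forall fun s => ?_)
    simp only [Pi.sub_apply]
    ring
  have habs : ∫ s in Set.Ioi 0, (s - C) * p s ≤ 0 := by
    have h1 := integral_comp_abs (f := fun s => (s - C) * p s)
    have h2 : ∫ x, (|x| - C) * p |x| = ∫ x, (|x| - C) ∂(gaussianReal 0 v) := by
      have := hp (fun x => |x| - C) Set.univ MeasurableSet.univ
      simp only [Measure.restrict_univ] at this
      rw [this]
      congr 1 with x
      simp [p, gaussianPDFReal]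
    have h3 := integral_abs_gaussianReal_le v
    rw [h2, integral_sub (integrable_abs_gaussianReal v) (by fun_prop)] at h1
    simp at h1
    linarith
  rw [hshift]
  calc ∫ s in Set.Ioi 0, (s - C) * p (s + y) ≤ ∫ s in Set.Ioi 0, w C * ((s - C) * p s) := by
        refine integral_mono hint2.integrableOn (hint.const_mul _).integrableOn fun s => ?_
        simp only [hwp]
        have hps : 0 ≤ p s := gaussianPDFReal_nonneg _ _ _
        have : (s - C) * w s ≤ (s - C) * w C := by
          rcases le_total s C with h | h
          · exact mul_le_mul_of_nonpos_left (hwa h) (by linarith)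
          · exact mul_le_mul_of_nonneg_left (hwa h) (by linarith)
        nlinarith [mul_le_mul_of_nonneg_right this hps]
    _ = w C * ∫ s in Set.Ioi 0, (s - C) * p s := integral_const_mul _ _
    _ ≤ 0 := mul_nonpos_of_nonneg_of_nonpos (Real.exp_pos _).le habs

theorem ae_le_killedWalk {v : ℕ → ℝ≥0} {b : ℕ → ℝ} (hb : 0 ≤ b 0) (m : ℕ) :
    ∀ᵐ x ∂(killedWalk v b m), x ≤ b m := by
  cases m with
  | zero => rw [killedWalk, ae_dirac_iff (measurableSet_Iic (a := b 0))]; exact hb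
  | succ m => rw [killedWalk_succ]; exact ae_restrict_mem measurableSet_Iic

theorem integrable_conv_gaussianReal {ν : Measure ℝ} [IsFiniteMeasure ν]
    (hν : Integrable (fun x => x) ν) (w : ℝ≥0) :
    Integrable (fun x => x) (ν.conv (gaussianReal 0 w)) := by
  rw [Measure.conv, integrable_map_measure (by fun_prop) (by fun_prop)]
  exact (hν.comp_fst _).add ((integrable_id_gaussianReal w).comp_snd _)

theorem integrable_killedWalk (v : ℕ → ℝ≥0) (b : ℕ → ℝ) (m : ℕ) :
    Integrable (fun x => x) (killedWalk v b m) := by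
  induction m with
  | zero => rw [killedWalk]; exact integrable_dirac (by simp)
  | succ m ih => rw [killedWalk_succ]; exact (integrable_conv_gaussianReal ih _).restrict

/-- The survival probability of the killed walk. -/
noncomputable def survival (v : ℕ → ℝ≥0) (b : ℕ → ℝ) (m : ℕ) : ℝ :=
  (killedWalk v b m).real Set.univ

theorem conv_real_univ (ν : Measure ℝ) [IsFiniteMeasure ν] (w : ℝ≥0) :
    (ν.conv (gaussianReal 0 w)).real Set.univ = ν.real Set.univ := by
  rw [Measure.conv, measureReal_def, Measure.map_apply (by fun_prop) .univ, Set.preimage_univ,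
    ← Set.univ_prod_univ, Measure.prod_prod]
  simp [measureReal_def]

theorem survival_zero (v : ℕ → ℝ≥0) (b : ℕ → ℝ) : survival v b 0 = 1 := by
  simp [survival, killedWalk]

theorem survival_nonneg (v : ℕ → ℝ≥0) (b : ℕ → ℝ) (m : ℕ) : 0 ≤ survival v b m :=
  measureReal_nonneg

theorem survival_sub_survival_succ (v : ℕ → ℝ≥0) (b : ℕ → ℝ) (m : ℕ) :
    survival v b m - survival v b (m + 1) =
      ((killedWalk v b m).conv (gaussianReal 0 (v m))).real (Set.Ioi (b (m + 1))) := by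
  have h : survival v b (m + 1) =
      ((killedWalk v b m).conv (gaussianReal 0 (v m))).real (Set.Iic (b (m + 1))) := by
    simp [survival, killedWalk_succ]
  rw [h, survival, ← conv_real_univ _ (v m), ← Set.compl_Iic, measureReal_compl measurableSet_Iic]

theorem survival_succ_le (v : ℕ → ℝ≥0) (b : ℕ → ℝ) (m : ℕ) :
    survival v b (m + 1) ≤ survival v b m := by
  have := survival_sub_survival_succ v b m
  linarith [measureReal_nonneg (μ := (killedWalk v b m).conv (gaussianReal 0 (v m)))
    (s := Set.Ioi (b (m + 1)))]

theorem survival_le_one (v : ℕ → ℝ≥0) (b : ℕ → ℝ) (m : ℕ) : survival v b m ≤ 1 :=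
  survival_zero v b ▸ antitone_nat_of_succ_le (survival_succ_le v b) m.zero_le

/-- One step of the optional stopping argument for the killed walk. -/
theorem integral_killedWalk_succ_ge {v : ℕ → ℝ≥0} {b : ℕ → ℝ} (hb : Monotone b) (hb0 : 0 ≤ b 0)
    {C : ℝ} (m : ℕ) (hC : (1 + v m) / 2 ≤ (C : ℝ)) :
    ∫ x, x ∂(killedWalk v b m) - (b (m + 1) + C) * (survival v b m - survival v b (m + 1)) ≤
      ∫ x, x ∂(killedWalk v b (m + 1)) := by
  set ν := killedWalk v b m
  set γ := gaussianReal 0 (v m)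
  set B := b (m + 1)
  have hi : Integrable (fun x => x) (ν.conv γ) :=
    integrable_conv_gaussianReal (integrable_killedWalk v b m) _
  have h1 : ∫ x, x ∂(ν.conv γ) = ∫ x, x ∂ν := by
    rw [integral_conv hi]
    refine integral_congr_ae (.of_forall fun x => ?_)
    simp only
    rw [integral_add (by fun_prop) (integrable_id_gaussianReal _), integral_id_gaussianReal]
    simp
  have h2 : ∫ x in Set.Iic B, x ∂(ν.conv γ) + ∫ x in Set.Ioi B, x ∂(ν.conv γ) =
      ∫ x, x ∂(ν.conv γ) := by
    rw [← Set.compl_Iic]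
    exact integral_add_compl measurableSet_Iic hi
  have hi' : Integrable (fun x => x - B - C) (ν.conv γ) :=
    (hi.sub (integrable_const B)).sub (integrable_const C)
  -- Given the position `x ≤ b m ≤ B` before the step, the overshoot bound applies at the level `B -
  -- x ≥ 0`.
  have h3 : ∫ x in Set.Ioi B, (x - B - C) ∂(ν.conv γ) ≤ 0 := by
    rw [← integral_indicator measurableSet_Ioi,
      integral_conv (hi'.indicator measurableSet_Ioi)]
    refine integral_nonpos_of_ae ?_
    filter_upwards [ae_le_killedWalk (v := v) hb0 m] with x hx
    have hxB : 0 ≤ B - x := sub_nonneg.2 (hx.trans (hb m.le_succ))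
    have := setIntegral_Ioi_sub_gaussianReal_nonpos hC hxB
    rw [← integral_indicator measurableSet_Ioi] at this
    refine le_of_eq_of_le (integral_congr_ae (.of_forall fun y => ?_)) this
    simp only [Set.indicator_apply, Set.mem_Ioi]
    by_cases h : B < x + y
    · rw [if_pos h, if_pos (by linarith)]; ring
    · rw [if_neg h, if_neg (by linarith)]
  have h4 : ∫ x in Set.Ioi B, (x - B - C) ∂(ν.conv γ) =
      ∫ x in Set.Ioi B, x ∂(ν.conv γ) - (B + C) * (ν.conv γ).real (Set.Ioi B) := by
    have : (fun x => x - B - C) = fun x => x - (B + C) := by ext x; ring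
    rw [this, integral_sub hi.restrict (by fun_prop)]
    simp [mul_comm]
  rw [survival_sub_survival_succ, killedWalk_succ]
  linarith

/-- The unkilled walk has mean zero, so the surviving part can be low on average only as far as the
killed part ended high, at most `C` above the barrier. Summation by parts moves the differences from
the survival probabilities to the barrier. -/
theorem neg_integral_killedWalk_le {v : ℕ → ℝ≥0} {b : ℕ → ℝ} (hb : Monotone b) (hb0 : 0 ≤ b 0)
    {C : ℝ} (m : ℕ) (hC : ∀ i < m, (1 + v i) / 2 ≤ (C : ℝ)) :
    -∫ x, x ∂(killedWalk v b m) ≤ b 0 + C - (b m + C) * survival v b m +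
      ∑ i ∈ Finset.range m, (b (i + 1) - b i) * survival v b i := by
  induction m with
  | zero => simp [killedWalk, survival_zero]
  | succ m ih =>
    have h := integral_killedWalk_succ_ge (v := v) hb hb0 m (hC m m.lt_succ_self)
    have h' := ih fun i hi => hC i (hi.trans m.lt_succ_self)
    rw [Finset.sum_range_succ]
    linarith

/-- The survival probability is controlled by the mean position of the killed walk. -/
theorem sqrt_mul_survival_le {v : ℕ → ℝ≥0} {b : ℕ → ℝ} (hb0 : 0 ≤ b 0) (hb : Monotone b)
    (m : ℕ) {s : ℝ} (hs : 0 ≤ s) :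
    s * (gaussianReal 0 (∑ i ∈ Finset.range m, v i)).real (Set.Iic (-s)) * survival v b m ≤
      -∫ x, x ∂(killedWalk v b m) + b m * survival v b m := by
  have hm : 0 ≤ b m := hb0.trans (hb m.zero_le)
  set ν := killedWalk v b m
  set φ : ℝ → ℝ := (Set.Iic (-s)).indicator 1 with hφ
  have hφa : Antitone φ := by
    intro x y hxy
    simp only [hφ, Set.indicator_apply, Set.mem_Iic, Pi.one_apply]
    split_ifs with h1 h2 <;> linarith
  have hφ' : ∀ x, φ x ∈ Set.Icc (0 : ℝ) 1 := by
    intro x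
    simp only [hφ, Set.indicator_apply, Pi.one_apply]
    split_ifs <;> simp
  have h := integral_mul_integral_killedWalk_le v b m φ (fun _ => 1) hφa antitone_const hφ'
    (by simp)
  have e1 : ∫ x, φ x ∂(gaussianReal 0 (∑ i ∈ Finset.range m, v i)) =
      (gaussianReal 0 (∑ i ∈ Finset.range m, v i)).real (Set.Iic (-s)) :=
    integral_indicator_one measurableSet_Iic
  simp only [e1, mul_one] at h
  have e2 : ∫ x, (1 : ℝ) ∂ν = survival v b m := by simp [survival, ν]
  rw [e2] at h
  -- The distance to the barrier is nonnegative for a surviving walk, and at least `s` where the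
  -- walk is below `-s`.
  have h5 : s * ∫ x, φ x ∂ν ≤ ∫ x, (b m - x) ∂ν := by
    rw [← integral_const_mul]
    refine integral_mono_ae ((integrable_of_antitone_of_mem_Icc hφa hφ').const_mul s)
      ((integrable_const _).sub (integrable_killedWalk v b m)) ?_
    filter_upwards [ae_le_killedWalk (v := v) hb0 m] with x hx
    simp only [hφ, Set.indicator_apply, Set.mem_Iic, Pi.one_apply]
    split_ifs with h1 <;> linarith
  rw [integral_sub (integrable_const _) (integrable_killedWalk v b m)] at h5
  have e3 : ∫ x, b m ∂ν = b m * survival v b m := by simp [survival, ν, mul_comm]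
  have := mul_le_mul_of_nonneg_left h hs
  linarith

/-! ### The ballot estimate -/

/-- A lower bound for the probability that a standard Gaussian is at most `-1`. -/
theorem gaussianReal_real_Iic_neg_sqrt {w : ℝ≥0} (hw : w ≠ 0) :
    (gaussianReal 0 w).real (Set.Iic (-√w)) = (gaussianReal 0 1).real (Set.Iic (-1)) := by
  have hs : 0 < √(w : ℝ) := Real.sqrt_pos.2 (by positivity)
  have h := gaussianReal_map_const_mul (μ := 0) (v := 1) (√(w : ℝ))
  have hv : NNReal.mk (√(w : ℝ) ^ 2) (sq_nonneg _) * 1 = w := by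
    rw [mul_one]; exact NNReal.eq (by simp)
  rw [mul_zero, hv] at h
  rw [← h, measureReal_def, Measure.map_apply (by fun_prop) measurableSet_Iic, measureReal_def]
  congr 2
  ext x
  simp only [Set.mem_preimage, Set.mem_Iic]
  constructor <;> intro h <;> nlinarith

theorem gaussianReal_real_Iic_neg_one_pos : 0 < (gaussianReal 0 1).real (Set.Iic (-1)) := by
  rw [measureReal_def, ENNReal.toReal_pos_iff]
  refine ⟨pos_iff_ne_zero.2 fun h => ?_, measure_lt_top _ _⟩
  have := gaussianReal_absolutelyContinuous' 0 one_ne_zero h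
  simp at this

theorem one_add_log_le_four_mul_rpow {x : ℝ} (hx : 0 < x) :
    1 + Real.log x ≤ 4 * x ^ (1 / 4 : ℝ) := by
  have h := Real.log_le_sub_one_of_pos (Real.rpow_pos_of_pos hx (1 / 4 : ℝ))
  rw [Real.log_rpow hx] at h
  linarith

theorem log_succ_sub_log_le (i : ℕ) : Real.log ((i + 1 : ℕ) : ℝ) - Real.log i ≤ (i : ℝ)⁻¹ := by
  -- At `i = 0` the conventions `Real.log 0 = 0` and `0⁻¹ = 0` make both sides vanish; the
  -- logarithmic barrier is thus flat from time `0` to time `1`.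
  rcases Nat.eq_zero_or_pos i with rfl | hi
  · simp
  · have hi' : (0 : ℝ) < i := by exact_mod_cast hi
    rw [← Real.log_div (by positivity) hi'.ne']
    refine (Real.log_le_sub_one_of_pos (by positivity)).trans (le_of_eq ?_)
    push_cast
    field_simp
    ring

theorem monotone_add_log_nat (a : ℝ) : Monotone fun m : ℕ => a + Real.log m := by
  refine monotone_nat_of_le_succ fun m => ?_
  rcases Nat.eq_zero_or_pos m with rfl | hm
  · simp
  · gcongr
    simp

/-- Ballot estimate for Gaussian random walks below a logarithmically growing barrier. -/
theorem exists_survival_le (D : ℝ) : ∃ C : ℝ, 0 < C ∧ ∀ (v : ℕ → ℝ≥0) (n : ℕ),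
    (∀ i < n, 1 / 4 ≤ (v i : ℝ)) → (∀ i < n, (v i : ℝ) ≤ D) → ∀ a : ℝ, 0 ≤ a →
      √n * survival v (fun m => a + Real.log m) n ≤ C * (a + 1) := by
  set p := (gaussianReal 0 1).real (Set.Iic (-1)) with hpd
  have hp : 0 < p := gaussianReal_real_Iic_neg_one_pos
  set E := |D| + 1 with hE
  have hE1 : 1 ≤ E := by simp [hE]
  -- The exponent is `1` from the barrier increment plus `1 / 4` from the crude decay of survival
  -- below.
  have hsum : Summable fun i : ℕ => (i : ℝ) ^ (-(5 / 4) : ℝ) :=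
    Real.summable_nat_rpow.2 (by norm_num)
  set Z := ∑' i : ℕ, (i : ℝ) ^ (-(5 / 4) : ℝ)
  have hZ : 0 ≤ Z := tsum_nonneg fun i => by positivity
  refine ⟨2 / p * (E * (1 + 10 / p * Z)), by positivity, fun v n hv1 hv2 a ha => ?_⟩
  set b : ℕ → ℝ := fun m => a + Real.log m with hbd
  have hb : Monotone b := monotone_add_log_nat a
  have hb0 : b 0 = a := by simp [hbd]
  have main (m : ℕ) (hm : m ≤ n) : √m * survival v b m ≤
      2 / p * (a + E + ∑ i ∈ Finset.range m, (i : ℝ)⁻¹ * survival v b i) := by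
    rcases Nat.eq_zero_or_pos m with rfl | hm0
    · simp; positivity
    set w : ℝ≥0 := ∑ i ∈ Finset.range m, v i with hw
    have hwm : (m : ℝ) / 4 ≤ w := by
      have : ∑ i ∈ Finset.range m, (1 / 4 : ℝ) ≤ ∑ i ∈ Finset.range m, (v i : ℝ) :=
        Finset.sum_le_sum fun i hi => hv1 i ((Finset.mem_range.1 hi).trans_le hm)
      simp only [Finset.sum_const, Finset.card_range, nsmul_eq_mul] at this
      rw [hw]; push_cast; linarith
    have hm0' : (0 : ℝ) < m := by exact_mod_cast hm0
    have hw0 : w ≠ 0 := fun h => by rw [h] at hwm; simp at hwm; linarith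
    have hsq : √m / 2 ≤ √w := by
      rw [show √(m : ℝ) / 2 = √((m : ℝ) / 4) by
        rw [Real.sqrt_div' _ (by norm_num), show (4 : ℝ) = 2 ^ 2 by norm_num,
          Real.sqrt_sq (by norm_num)]]
      exact Real.sqrt_le_sqrt hwm
    have h1 := sqrt_mul_survival_le (v := v) (by rw [hb0]; exact ha) hb m (Real.sqrt_nonneg w)
    rw [gaussianReal_real_Iic_neg_sqrt hw0, ← hpd] at h1
    have h2 := neg_integral_killedWalk_le (v := v) hb (by rw [hb0]; exact ha) (C := E) m
      fun i hi => by
        have := hv2 i (hi.trans_le hm)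
        have := le_abs_self D
        have := abs_nonneg D
        linarith
    have h3 : ∑ i ∈ Finset.range m, (b (i + 1) - b i) * survival v b i ≤
        ∑ i ∈ Finset.range m, (i : ℝ)⁻¹ * survival v b i := by
      refine Finset.sum_le_sum fun i _ => mul_le_mul_of_nonneg_right ?_ (survival_nonneg v b i)
      simp only [hbd]
      linarith [log_succ_sub_log_le i]
    rw [hb0] at h2
    have h4 : √m / 2 * p * survival v b m ≤ √w * p * survival v b m := by
      have := survival_nonneg v b m
      gcongr
    -- The terms in `b m` cancel between `h1` and `h2`, so the growth of the barrier enters only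
    -- through the sum. What remains is `-E * survival`, which is dropped.
    have h5 : 0 ≤ E * survival v b m := mul_nonneg (by linarith) (survival_nonneg v b m)
    rw [div_mul_eq_mul_div, le_div_iff₀ hp]
    nlinarith
  have hsumlog (m : ℕ) : ∑ i ∈ Finset.range m, (i : ℝ)⁻¹ * survival v b i ≤ 1 + Real.log m := by
    calc _ ≤ ∑ i ∈ Finset.range m, (i : ℝ)⁻¹ := Finset.sum_le_sum fun i _ =>
          mul_le_of_le_one_right (by positivity) (survival_le_one v b i)
      _ ≤ 1 + Real.log m := by
          have h := harmonic_le_one_add_log m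
          have h' : ∑ i ∈ Finset.range m, (i : ℝ)⁻¹ ≤ ∑ i ∈ Finset.range m, ((i + 1 : ℕ) : ℝ)⁻¹ := by
            clear h
            cases m with
            | zero => simp
            | succ k =>
              rw [Finset.sum_range_succ' , Finset.sum_range_succ]
              simp
              positivity
          refine h'.trans (le_of_eq_of_le ?_ h)
          simp [harmonic]
  -- First pass of the bootstrap: bounding survival by `1` in the sum costs a logarithm, traded for
  -- `i ^ (1 / 4)`. The factor `10` is `2 * 5`, from `a + E + 1 + log i ≤ 5 (a + E) i ^ (1 / 4)`.
  -- Reinserting this decay makes the sum converge.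
  have crude (i : ℕ) (hi : i ≤ n) (hi0 : 0 < i) :
      survival v b i ≤ 10 / p * (a + E) * (i : ℝ) ^ (-(1 / 4) : ℝ) := by
    have hi' : (0 : ℝ) < i := by exact_mod_cast hi0
    have h1 := main i hi
    have h2 := hsumlog i
    have h3 := one_add_log_le_four_mul_rpow hi'
    have h4 : (1 : ℝ) ≤ (i : ℝ) ^ (1 / 4 : ℝ) :=
      Real.one_le_rpow (by exact_mod_cast hi0) (by norm_num)
    have h5 : √(i : ℝ) = (i : ℝ) ^ (1 / 4 : ℝ) * (i : ℝ) ^ (1 / 4 : ℝ) := by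
      rw [← Real.rpow_add hi', Real.sqrt_eq_rpow]; norm_num
    have h6 : (i : ℝ) ^ (1 / 4 : ℝ) * ((i : ℝ) ^ (1 / 4 : ℝ) * survival v b i) ≤
        (i : ℝ) ^ (1 / 4 : ℝ) * (10 / p * (a + E)) := by
      rw [← mul_assoc, ← h5]
      refine h1.trans ?_
      rw [show (i : ℝ) ^ (1 / 4 : ℝ) * (10 / p * (a + E)) =
        2 / p * (5 * (a + E) * (i : ℝ) ^ (1 / 4 : ℝ)) by ring]
      gcongr
      nlinarith
    have h7 := le_of_mul_le_mul_left h6 (by linarith)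
    rw [Real.rpow_neg hi'.le, ← div_eq_mul_inv, le_div_iff₀ (by linarith)]
    linarith
  have h1 := main n le_rfl
  have h2 : ∑ i ∈ Finset.range n, (i : ℝ)⁻¹ * survival v b i ≤ 10 / p * (a + E) * Z := by
    calc _ ≤ ∑ i ∈ Finset.range n, 10 / p * (a + E) * (i : ℝ) ^ (-(5 / 4) : ℝ) := by
          refine Finset.sum_le_sum fun i hi => ?_
          rcases Nat.eq_zero_or_pos i with rfl | hi0
          · simp
          · have hi' : (0 : ℝ) < i := by exact_mod_cast hi0
            have := mul_le_mul_of_nonneg_left (crude i (Finset.mem_range.1 hi).le hi0)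
              (inv_nonneg.2 hi'.le)
            refine this.trans (le_of_eq ?_)
            rw [show (-(5 / 4) : ℝ) = -(1 / 4) + -1 by norm_num, Real.rpow_add hi',
              Real.rpow_neg_one]
            ring
      _ = 10 / p * (a + E) * ∑ i ∈ Finset.range n, (i : ℝ) ^ (-(5 / 4) : ℝ) := by
          rw [Finset.mul_sum]
      _ ≤ 10 / p * (a + E) * Z := by
          gcongr
          exact hsum.sum_le_tsum _ fun i _ => by positivity
  have h3 : a + E ≤ E * (a + 1) := by nlinarith
  calc √n * survival v b n ≤ 2 / p * (a + E + 10 / p * (a + E) * Z) := by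
        refine h1.trans ?_
        gcongr
    _ = 2 / p * ((a + E) * (1 + 10 / p * Z)) := by ring
    _ ≤ 2 / p * ((E * (a + 1)) * (1 + 10 / p * Z)) := by gcongr
    _ = _ := by ring

/-! ### Exponential tilting -/

theorem lintegral_exp_two_mul_mul_gaussianReal (v : ℝ≥0) {f : ℝ → ℝ≥0∞} (hf : Measurable f) :
    ∫⁻ y, ENNReal.ofReal (Real.exp (2 * y)) * f y ∂(gaussianReal 0 v) =
      ENNReal.ofReal (Real.exp (2 * v)) * ∫⁻ y, f (y + 2 * v) ∂(gaussianReal 0 v) := by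
  by_cases hv : v = 0
  · subst hv
    simp [gaussianReal_zero_var, lintegral_dirac]
  have hv0 : (0 : ℝ) < v := by positivity
  have hm := measurable_gaussianPDF 0 v
  rw [gaussianReal_of_var_ne_zero _ hv, lintegral_withDensity_eq_lintegral_mul _ hm (by fun_prop),
    lintegral_withDensity_eq_lintegral_mul _ hm (by fun_prop),
    ← lintegral_add_right_eq_self _ (2 * (v : ℝ)), ← lintegral_const_mul _ (by fun_prop)]
  refine lintegral_congr fun y => ?_
  simp only [Pi.mul_apply, gaussianPDF]
  rw [← mul_assoc, ← mul_assoc, ← ENNReal.ofReal_mul (gaussianPDFReal_nonneg _ _ _),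
    ← ENNReal.ofReal_mul (Real.exp_pos _).le]
  congr 2
  -- Completing the square: `2 (y + 2 v) - (y + 2 v)² / (2 v) = 2 v - y² / (2 v)`.
  simp only [gaussianPDFReal]
  rw [mul_assoc, ← Real.exp_add, mul_left_comm, ← Real.exp_add]
  congr 2
  field_simp
  ring

/-- Exponential tilting of a killed Gaussian walk turns it into a walk with drift. -/
theorem lintegral_exp_two_mul_killedWalk (v : ℕ → ℝ≥0) (b : ℕ → ℝ) (m : ℕ) :
    ∀ f : ℝ → ℝ≥0∞, Measurable f →
      ∫⁻ x, ENNReal.ofReal (Real.exp (2 * x)) * f x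
        ∂(killedWalk v (fun i => b i + 2 * ∑ j ∈ Finset.range i, (v j : ℝ)) m) =
      ENNReal.ofReal (Real.exp (2 * ∑ j ∈ Finset.range m, (v j : ℝ))) *
        ∫⁻ x, f (x + 2 * ∑ j ∈ Finset.range m, (v j : ℝ)) ∂(killedWalk v b m) := by
  set c : ℕ → ℝ := fun i => b i + 2 * ∑ j ∈ Finset.range i, (v j : ℝ) with hc
  induction m with
  | zero => intro f hf; simp [killedWalk]
  | succ m ih =>
    intro f hf
    set s : ℝ := ∑ j ∈ Finset.range m, (v j : ℝ)
    set h : ℝ → ℝ≥0∞ := (Set.Iic (c (m + 1))).indicator f with hh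
    have hhm : Measurable h := hf.indicator measurableSet_Iic
    have e1 : ∫⁻ x, ENNReal.ofReal (Real.exp (2 * x)) * f x ∂(killedWalk v c (m + 1)) =
        ∫⁻ x, ∫⁻ y, ENNReal.ofReal (Real.exp (2 * (x + y))) * h (x + y)
          ∂(gaussianReal 0 (v m)) ∂(killedWalk v c m) := by
      rw [killedWalk_succ, ← lintegral_indicator measurableSet_Iic,
        ← Measure.lintegral_conv (f := fun z => ENNReal.ofReal (Real.exp (2 * z)) * h z)
          (by fun_prop)]
      refine lintegral_congr fun x => ?_
      by_cases hx : x ∈ Set.Iic (c (m + 1)) <;> simp only [hh, Set.indicator, hx] <;> simp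
    have e2 (x : ℝ) : ∫⁻ y, ENNReal.ofReal (Real.exp (2 * (x + y))) * h (x + y)
        ∂(gaussianReal 0 (v m)) = ENNReal.ofReal (Real.exp (2 * x)) *
          (ENNReal.ofReal (Real.exp (2 * v m)) *
            ∫⁻ y, h (x + (y + 2 * v m)) ∂(gaussianReal 0 (v m))) := by
      rw [← lintegral_exp_two_mul_mul_gaussianReal (v m) (f := fun y => h (x + y)) (by fun_prop),
        ← lintegral_const_mul _ (by fun_prop)]
      refine lintegral_congr fun y => ?_
      rw [mul_add, Real.exp_add, ENNReal.ofReal_mul (Real.exp_pos _).le, mul_assoc]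
    rw [e1, lintegral_congr e2, ih _ (by fun_prop), lintegral_const_mul _ (by fun_prop),
      ← mul_assoc, ← ENNReal.ofReal_mul (Real.exp_pos _).le, ← Real.exp_add,
      Finset.sum_range_succ, mul_add]
    congr 1
    rw [killedWalk_succ, ← lintegral_indicator measurableSet_Iic,
      Measure.lintegral_conv (by
        exact (hf.comp (measurable_id.add_const _)).indicator measurableSet_Iic)]
    refine lintegral_congr fun x => lintegral_congr fun y => ?_
    have hx : x + 2 * s + (y + 2 * v m) = x + y + (2 * s + 2 * v m) := by ring
    have hiff : x + y + (2 * s + 2 * v m) ≤ c (m + 1) ↔ x + y ≤ b (m + 1) := by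
      simp only [hc, Finset.sum_range_succ]
      constructor <;> intro h <;> linarith
    rw [hx]
    simp only [hh, Set.indicator_apply, Set.mem_Iic, hiff]
    rfl

/-! ### Sums of independent Gaussians observed along a subsequence -/

/-- The σ-algebra generated by the variables `g i`, `i ∈ s`. -/
abbrev sigmaGen {Ω : Type*} (g : ℕ → Ω → ℝ) (s : Set ℕ) : MeasurableSpace Ω :=
  ⨆ i ∈ s, MeasurableSpace.comap (g i) inferInstance

theorem measurable_sigmaGen {Ω : Type*} (g : ℕ → Ω → ℝ) {s : Set ℕ} {i : ℕ} (hi : i ∈ s) :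
    Measurable[sigmaGen g s] (g i) :=
  Measurable.mono (comap_measurable (g i)) (le_iSup₂_of_le i hi le_rfl) le_rfl

theorem sigmaGen_le {Ω : Type*} [mΩ : MeasurableSpace Ω] {g : ℕ → Ω → ℝ}
    (hm : ∀ i, Measurable (g i)) (s : Set ℕ) : sigmaGen g s ≤ mΩ :=
  iSup₂_le fun i _ => (hm i).comap_le

theorem measurableSet_alive {Ω : Type*} {mΩ : MeasurableSpace Ω} {g : ℕ → Ω → ℝ} {N : ℕ → ℕ} (b : ℕ → ℝ)
    (m : ℕ) (h : ∀ i ≤ m, Measurable fun ω => ∑ j ∈ Finset.range (N i), g j ω) :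
    MeasurableSet {ω | ∀ i, 1 ≤ i → i ≤ m → ∑ j ∈ Finset.range (N i), g j ω ≤ b i} := by
  have : {ω | ∀ i, 1 ≤ i → i ≤ m → ∑ j ∈ Finset.range (N i), g j ω ≤ b i} =
      ⋂ i ∈ Finset.Icc 1 m, (fun ω => ∑ j ∈ Finset.range (N i), g j ω) ⁻¹' Set.Iic (b i) := by
    ext ω; simp
  rw [this]
  exact Finset.measurableSet_biInter _ fun i hi => h i (Finset.mem_Icc.1 hi).2 measurableSet_Iic

theorem measurable_sum_range_sigmaGen {Ω : Type*} (g : ℕ → Ω → ℝ) {k n : ℕ} (h : k ≤ n) :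
    Measurable[sigmaGen g (Finset.range n : Set ℕ)] fun ω => ∑ j ∈ Finset.range k, g j ω :=
  Finset.measurable_sum _ fun _ hj => measurable_sigmaGen g
    (Finset.mem_coe.2 (Finset.range_mono h hj))

theorem disjoint_range_Ico (a b : ℕ) :
    Disjoint (Finset.range a : Set ℕ) (Finset.Ico a b : Set ℕ) := by
  rw [Finset.disjoint_coe, Finset.disjoint_left]
  intro x hx hx'
  simp at hx hx'
  omega

section

variable {Ω : Type*} [MeasurableSpace Ω] {μ : Measure Ω}

theorem map_sum_gaussianReal [IsProbabilityMeasure μ] {g : ℕ → Ω → ℝ} {w : ℕ → ℝ≥0}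
    (hm : ∀ i, Measurable (g i)) (hi : iIndepFun g μ)
    (hg : ∀ i, μ.map (g i) = gaussianReal 0 (w i)) (s : Finset ℕ) :
    μ.map (fun ω => ∑ i ∈ s, g i ω) = gaussianReal 0 (∑ i ∈ s, w i) := by
  induction s using Finset.induction_on with
  | empty => simp [gaussianReal_zero_var]
  | insert a s ha ih =>
    have h1 : IndepFun (g a) (fun ω => ∑ i ∈ s, g i ω) μ := by
      have := (hi.indepFun_finsetSum_of_notMem hm ha).symm
      convert this using 1
      ext ω; simp
    have := gaussianReal_add_gaussianReal_of_indepFun h1 (hg a) ih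
    rw [add_zero] at this
    rw [Finset.sum_insert ha, ← this]
    congr 1
    ext ω
    simp [Finset.sum_insert ha]

theorem indep_sigmaGen {g : ℕ → Ω → ℝ} (hm : ∀ i, Measurable (g i)) (hi : iIndepFun g μ)
    {s t : Set ℕ} (hst : Disjoint s t) : Indep (sigmaGen g s) (sigmaGen g t) μ :=
  indep_iSup_of_disjoint (fun i => (hm i).comap_le) hi.iIndep hst

/-- The law of a Gaussian walk observed at the times `N 1, …, N m`, restricted to the event that
it stays below the barrier at those times. -/
theorem map_restrict_alive [IsProbabilityMeasure μ] {g : ℕ → Ω → ℝ} {w : ℕ → ℝ≥0}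
    (hm : ∀ i, Measurable (g i)) (hi : iIndepFun g μ)
    (hg : ∀ i, μ.map (g i) = gaussianReal 0 (w i)) {N : ℕ → ℕ} (hN : Monotone N) (hN0 : N 0 = 0)
    (b : ℕ → ℝ) (m : ℕ) :
    (μ.restrict {ω | ∀ i, 1 ≤ i → i ≤ m → ∑ j ∈ Finset.range (N i), g j ω ≤ b i}).map
        (fun ω => ∑ j ∈ Finset.range (N m), g j ω) =
      killedWalk (fun i => ∑ j ∈ Finset.Ico (N i) (N (i + 1)), w j) b m := by
  induction m with
  | zero =>
    have : {ω | ∀ i, 1 ≤ i → i ≤ 0 → ∑ j ∈ Finset.range (N i), g j ω ≤ b i} = Set.univ := by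
      ext ω; simp; intro i h1 h2; omega
    rw [this]
    simp [hN0, killedWalk]
  | succ m ih =>
    set A : Set Ω := {ω | ∀ i, 1 ≤ i → i ≤ m → ∑ j ∈ Finset.range (N i), g j ω ≤ b i} with hA
    set S : Ω → ℝ := fun ω => ∑ j ∈ Finset.range (N m), g j ω with hS
    set Y : Ω → ℝ := fun ω => ∑ j ∈ Finset.Ico (N m) (N (m + 1)), g j ω with hY
    have hSm : Measurable S := Finset.measurable_sum _ fun i _ => hm i
    have hYm : Measurable Y := Finset.measurable_sum _ fun i _ => hm i
    have hSY : (fun ω => ∑ j ∈ Finset.range (N (m + 1)), g j ω) = fun ω => S ω + Y ω := by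
      ext ω
      exact (Finset.sum_range_add_sum_Ico _ (hN m.le_succ)).symm
    have hind : Indep (sigmaGen g (Finset.range (N m) : Set ℕ))
        (sigmaGen g (Finset.Ico (N m) (N (m + 1)) : Set ℕ)) μ  :=
      indep_sigmaGen hm hi (disjoint_range_Ico _ _)
    have hS1 (i : ℕ) (h : i ≤ m) : Measurable[sigmaGen g (Finset.range (N m) : Set ℕ)]
        fun ω => ∑ j ∈ Finset.range (N i), g j ω :=
      measurable_sum_range_sigmaGen g (hN h)
    have hY2 : Measurable[sigmaGen g (Finset.Ico (N m) (N (m + 1)) : Set ℕ)] Y :=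
      Finset.measurable_sum _ fun j hj => measurable_sigmaGen g (Finset.mem_coe.2 hj)
    have hA1 : MeasurableSet[sigmaGen g (Finset.range (N m) : Set ℕ)] A :=
      measurableSet_alive b m hS1
    -- Survival up to time `m` and the position `S` involve only the variables before `N m`, so the
    -- next block `Y` stays independent of `S` after restriction to `A`.
    have hprod : (μ.restrict A).map (fun ω => (S ω, Y ω)) =
        ((μ.restrict A).map S).prod (μ.map Y) := by
      refine (Measure.prod_eq fun s t hs ht => ?_).symm
      rw [Measure.map_apply (by fun_prop) (hs.prod ht), Measure.map_apply hSm hs,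
        Measure.map_apply hYm ht, Measure.restrict_apply (hSm hs),
        Measure.restrict_apply ((hSm.prodMk hYm) (hs.prod ht))]
      have := (Indep_iff _ _ _).1 hind (S ⁻¹' s ∩ A) (Y ⁻¹' t)
        (MeasurableSet.inter (hS1 m le_rfl hs) hA1) (hY2 ht)
      rw [← this]
      congr 1
      ext ω
      simp
      tauto
    have hAsucc : {ω | ∀ i, 1 ≤ i → i ≤ m + 1 → ∑ j ∈ Finset.range (N i), g j ω ≤ b i} =
        (fun ω => S ω + Y ω) ⁻¹' Set.Iic (b (m + 1)) ∩ A := by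
      ext ω
      simp only [hA, ← hSY, Set.mem_inter_iff, Set.mem_preimage, Set.mem_Iic, Set.mem_ofPred_eq]
      constructor
      · exact fun h => ⟨h _ (by omega) le_rfl, fun i h1 h2 => h i h1 (by omega)⟩
      · rintro ⟨h1, h2⟩ i h3 h4
        rcases Nat.lt_or_ge i (m + 1) with h5 | h5
        · exact h2 i h3 (by omega)
        · rwa [show i = m + 1 by omega]
    have hSYm : Measurable fun ω => S ω + Y ω := hSm.add hYm
    rw [hAsucc, hSY, ← Measure.restrict_restrict (hSYm measurableSet_Iic),
      ← Measure.restrict_map hSYm measurableSet_Iic, killedWalk_succ, ← ih, Measure.conv,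
      ← map_sum_gaussianReal hm hi hg, ← hprod, Measure.map_map (by fun_prop) (by fun_prop)]
    rfl

theorem lintegral_exp_two_mul_gaussianReal (v : ℝ≥0) :
    ∫⁻ y, ENNReal.ofReal (Real.exp (2 * y)) ∂(gaussianReal 0 v) =
      ENNReal.ofReal (Real.exp (2 * v)) := by
  have := lintegral_exp_two_mul_mul_gaussianReal v (f := fun _ => 1) measurable_const
  simpa using this

theorem lintegral_exp_two_mul_sum [IsProbabilityMeasure μ] {g : ℕ → Ω → ℝ} {w : ℕ → ℝ≥0}
    (hm : ∀ i, Measurable (g i)) (hi : iIndepFun g μ)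
    (hg : ∀ i, μ.map (g i) = gaussianReal 0 (w i)) (s : Finset ℕ) :
    ∫⁻ ω, ENNReal.ofReal (Real.exp (2 * ∑ i ∈ s, g i ω)) ∂μ =
      ENNReal.ofReal (Real.exp (2 * ∑ i ∈ s, (w i : ℝ))) := by
  have h := lintegral_exp_two_mul_gaussianReal (∑ i ∈ s, w i)
  rw [← map_sum_gaussianReal hm hi hg s, lintegral_map (by fun_prop) (by fun_prop)] at h
  rw [h]
  push_cast
  rfl

/-- The exponential moment of a Gaussian walk on the event that it stays below a barrier. -/
theorem setLIntegral_alive_exp_two_mul_sum [IsProbabilityMeasure μ] {g : ℕ → Ω → ℝ} {w : ℕ → ℝ≥0}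
    (hm : ∀ i, Measurable (g i)) (hi : iIndepFun g μ)
    (hg : ∀ i, μ.map (g i) = gaussianReal 0 (w i)) {N : ℕ → ℕ} (hN : Monotone N) (hN0 : N 0 = 0)
    (b : ℕ → ℝ) (m : ℕ) {M : ℕ} (hM : N m ≤ M) :
    ∫⁻ ω in {ω | ∀ i, 1 ≤ i → i ≤ m → ∑ j ∈ Finset.range (N i), g j ω ≤
        b i + 2 * ∑ j ∈ Finset.range (N i), (w j : ℝ)},
        ENNReal.ofReal (Real.exp (2 * ∑ j ∈ Finset.range M, g j ω)) ∂μ =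
      ENNReal.ofReal (Real.exp (2 * ∑ j ∈ Finset.range M, (w j : ℝ))) *
        ENNReal.ofReal (survival (fun i => ∑ j ∈ Finset.Ico (N i) (N (i + 1)), w j) b m) := by
  set v : ℕ → ℝ≥0 := fun i => ∑ j ∈ Finset.Ico (N i) (N (i + 1)), w j with hv
  have hsum (i : ℕ) : ∑ j ∈ Finset.range (N i), (w j : ℝ) = ∑ k ∈ Finset.range i, (v k : ℝ) := by
    induction i with
    | zero => simp [hN0]
    | succ i ih =>
      rw [Finset.sum_range_succ, ← ih, ← Finset.sum_range_add_sum_Ico _ (hN i.le_succ)]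
      simp [hv]
  set c : ℕ → ℝ := fun i => b i + 2 * ∑ j ∈ Finset.range i, (v j : ℝ) with hc
  have hset : {ω | ∀ i, 1 ≤ i → i ≤ m → ∑ j ∈ Finset.range (N i), g j ω ≤
      b i + 2 * ∑ j ∈ Finset.range (N i), (w j : ℝ)} =
      {ω | ∀ i, 1 ≤ i → i ≤ m → ∑ j ∈ Finset.range (N i), g j ω ≤ c i} := by
    simp only [hsum, hc]
  rw [hset]
  set A := {ω | ∀ i, 1 ≤ i → i ≤ m → ∑ j ∈ Finset.range (N i), g j ω ≤ c i} with hA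
  have hA1 : MeasurableSet[sigmaGen g (Finset.range (N m) : Set ℕ)] A :=
    measurableSet_alive c m fun i h => measurable_sum_range_sigmaGen g (hN h)
  have hAm : MeasurableSet A := sigmaGen_le hm _ _ hA1
  have hSm : Measurable fun ω => ∑ j ∈ Finset.range (N m), g j ω :=
    Finset.measurable_sum _ fun i _ => hm i
  have h1 : ∫⁻ ω in A, ENNReal.ofReal (Real.exp (2 * ∑ j ∈ Finset.range (N m), g j ω)) ∂μ =
      ENNReal.ofReal (Real.exp (2 * ∑ j ∈ Finset.range (N m), (w j : ℝ))) *
        ENNReal.ofReal (survival v b m) := by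
    have h := lintegral_exp_two_mul_killedWalk v b m (fun _ => 1) measurable_const
    rw [← hc, hv, ← map_restrict_alive hm hi hg hN hN0 c m,
      lintegral_map (by fun_prop) hSm] at h
    simp only [mul_one] at h
    rw [h, hsum]
    simp [survival, hv]
  -- The variables after the last observation are unconstrained and independent of the event; they
  -- contribute their full exponential moment.
  have h2 := lintegral_exp_two_mul_sum hm hi hg (Finset.Ico (N m) M)
  have h3 : ∫⁻ ω in A, ENNReal.ofReal (Real.exp (2 * ∑ j ∈ Finset.range M, g j ω)) ∂μ =
      ∫⁻ ω, A.indicator (fun ω => ENNReal.ofReal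
        (Real.exp (2 * ∑ j ∈ Finset.range (N m), g j ω))) ω *
        ENNReal.ofReal (Real.exp (2 * ∑ j ∈ Finset.Ico (N m) M, g j ω)) ∂μ := by
    rw [← lintegral_indicator hAm]
    refine lintegral_congr fun ω => ?_
    by_cases hω : ω ∈ A
    · simp only [Set.indicator_of_mem hω]
      rw [← ENNReal.ofReal_mul (Real.exp_pos _).le, ← Real.exp_add, ← mul_add,
        Finset.sum_range_add_sum_Ico _ hM]
    · simp [Set.indicator_of_notMem hω]
  rw [h3, lintegral_mul_eq_lintegral_mul_lintegral_of_independent_measurableSpace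
    (sigmaGen_le hm (Finset.range (N m) : Set ℕ)) (sigmaGen_le hm (Finset.Ico (N m) M : Set ℕ))
    (indep_sigmaGen hm hi (disjoint_range_Ico _ _)) ?_ ?_, lintegral_indicator hAm, h1, h2,
    mul_right_comm, ← ENNReal.ofReal_mul (Real.exp_pos _).le, ← Real.exp_add, ← mul_add,
    Finset.sum_range_add_sum_Ico _ hM]
  · refine Measurable.indicator ?_ hA1
    exact ENNReal.measurable_ofReal.comp (Real.measurable_exp.comp
      ((measurable_sum_range_sigmaGen g le_rfl).const_mul 2))
  · refine ENNReal.measurable_ofReal.comp (Real.measurable_exp.comp (Measurable.const_mul ?_ 2))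
    exact Finset.measurable_sum _ fun j hj => measurable_sigmaGen g (Finset.mem_coe.2 hj)

end

/-! ### The random series as a Gaussian walk -/

theorem map_re_mul_stdComplexGaussian (c : ℂ) :
    stdComplexGaussian.map (fun x => (x * c).re) = gaussianReal 0 (‖c‖₊ ^ 2 / 2) := by
  have hm : Measurable fun p : ℝ × ℝ => (⟨p.1, p.2⟩ : ℂ) :=
    Complex.measurableEquivRealProd.symm.measurable
  rw [stdComplexGaussian, Measure.map_map (by fun_prop) hm]
  have h1 : ((fun x : ℂ => (x * c).re) ∘ fun p : ℝ × ℝ => (⟨p.1, p.2⟩ : ℂ)) =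
      (fun p : ℝ × ℝ => p.1 + p.2) ∘ Prod.map (fun x => c.re * x) (fun x => -c.im * x) := by
    ext p
    simp
    ring
  rw [h1, ← Measure.map_map (by fun_prop) (by fun_prop),
    ← Measure.map_prod_map _ _ (by fun_prop) (by fun_prop), gaussianReal_map_const_mul,
    gaussianReal_map_const_mul]
  have := gaussianReal_conv_gaussianReal (m₁ := c.re * 0) (m₂ := -c.im * 0)
    (v₁ := .mk (c.re ^ 2) (sq_nonneg _) * (1 / 2)) (v₂ := .mk ((-c.im) ^ 2) (sq_nonneg _) * (1 / 2))
  rw [Measure.conv] at this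
  rw [this]
  congr 1
  · simp
  · apply NNReal.eq
    have h := Complex.sq_norm c
    rw [Complex.normSq_apply] at h
    simp [h]
    ring

/-- The variance of the `(i + 1)`-st term of the random series on the circle of radius `r`. -/
noncomputable def termVar (r : ℝ) (i : ℕ) : ℝ≥0 :=
  (r ^ (2 * (i + 1)) / (2 * (i + 1))).toNNReal

theorem coe_termVar (r : ℝ) (i : ℕ) : (termVar r i : ℝ) = r ^ (2 * (i + 1)) / (2 * (i + 1)) := by
  rw [termVar, Real.coe_toNNReal]
  rw [pow_mul]
  positivity

/-- The real part of the `(i + 1)`-st term of the random series. -/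
noncomputable def termRe (x : ℕ → ℂ) (z : ℂ) (i : ℕ) : ℝ :=
  (x (i + 1) / (Real.sqrt ((i + 1 : ℕ) : ℝ) : ℂ) * z ^ (i + 1)).re

/-- Since `‖exp w‖² = exp (2 Re w)`, second moments of the random function are exponential moments
of the walk with tilt `2`. -/
theorem norm_genF_sq (x : ℕ → ℂ) (K : ℝ) (z : ℂ) :
    ‖genF x K z‖ ^ 2 = Real.exp (2 * ∑ i ∈ Finset.range ⌊K⌋₊, termRe x z i) := by
  rw [genF, Complex.norm_exp, ← Real.exp_nat_mul, Complex.re_sum]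
  congr 2
  have := Finset.sum_Ico_add' (fun k : ℕ => (x k / (Real.sqrt (k : ℝ) : ℂ) * z ^ k).re) 0 ⌊K⌋₊ 1
  rw [← Finset.range_eq_Ico, zero_add] at this
  exact this.symm

section

variable {Ω : Type*} [MeasurableSpace Ω] {μ : Measure Ω}

theorem measurable_termRe {X : ℕ → Ω → ℂ} (hXm : ∀ k, Measurable (X k)) (z : ℂ) (i : ℕ) :
    Measurable fun ω => termRe (fun k => X k ω) z i := by
  unfold termRe
  fun_prop

theorem map_termRe {X : ℕ → Ω → ℂ} (hX : IsStdComplexGaussianSeq X μ)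
    (z : ℂ) (i : ℕ) :
    μ.map (fun ω => termRe (fun k => X k ω) z i) = gaussianReal 0 (termVar ‖z‖ i) := by
  set c : ℂ := z ^ (i + 1) / (Real.sqrt ((i + 1 : ℕ) : ℝ) : ℂ) with hc
  have h1 : (fun ω => termRe (fun k => X k ω) z i) = (fun x => (x * c).re) ∘ X (i + 1) := by
    ext ω
    simp only [termRe, hc, Function.comp]
    congr 1
    ring
  have hl := hX.hasLaw (i + 1) (by omega)
  rw [h1, ← AEMeasurable.map_map_of_aemeasurable (by fun_prop) hl.aemeasurable, hl.map_eq,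
    map_re_mul_stdComplexGaussian]
  congr 1
  apply NNReal.eq
  rw [coe_termVar]
  simp only [hc, NNReal.coe_div, NNReal.coe_pow, coe_nnnorm, norm_div, norm_pow]
  rw [Complex.norm_real, Real.norm_of_nonneg (Real.sqrt_nonneg _), div_pow, Real.sq_sqrt (by positivity)]
  push_cast
  field_simp
  ring

theorem iIndepFun_termRe {X : ℕ → Ω → ℂ} (hX : IsStdComplexGaussianSeq X μ) (z : ℂ) :
    iIndepFun (fun i ω => termRe (fun k => X k ω) z i) μ := by
  have h := hX.indep.precomp Nat.succPNat_injective
  exact h.comp (fun i x => (x / (Real.sqrt ((i + 1 : ℕ) : ℝ) : ℂ) * z ^ (i + 1)).re)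
    fun i => by fun_prop

theorem two_mul_sum_termVar (r : ℝ) (N : ℕ) :
    2 * ∑ i ∈ Finset.range N, (termVar r i : ℝ) =
      ∑ i ∈ Finset.range N, r ^ (2 * (i + 1)) / (i + 1) := by
  rw [Finset.mul_sum]
  refine Finset.sum_congr rfl fun i _ => ?_
  rw [coe_termVar]
  field_simp

/-- With `k = i + 1 ≤ N`, convexity gives `r ^ (2k) ≤ exp (4k / N) ≤ 1 + (k / N) exp 4`. Hence the
radius adds only `exp 4 / N` to each `1 / k`, and `exp 4` to the harmonic sum. -/
theorem exp_two_mul_sum_termVar_le {r : ℝ} {N : ℕ} (hr : 0 ≤ r) (hN : 1 ≤ N)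
    (hrN : r ≤ Real.exp (2 / N)) :
    Real.exp (2 * ∑ i ∈ Finset.range N, (termVar r i : ℝ)) ≤
      Real.exp (1 + Real.exp 4) * N := by
  have hN0 : (0 : ℝ) < N := by exact_mod_cast hN
  rw [two_mul_sum_termVar]
  have key (i : ℕ) (hi : i ∈ Finset.range N) : r ^ (2 * (i + 1)) / (i + 1 : ℝ) ≤
      ((i + 1 : ℕ) : ℝ)⁻¹ + Real.exp 4 / N := by
    set x : ℝ := (i + 1) / N with hx
    have hx0 : 0 ≤ x := by positivity
    have hx1 : x ≤ 1 := by
      rw [hx, div_le_one hN0]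
      exact_mod_cast Finset.mem_range.1 hi
    have h1 : r ^ (2 * (i + 1)) ≤ Real.exp (x * 4) := by
      calc r ^ (2 * (i + 1)) ≤ Real.exp (2 / N) ^ (2 * (i + 1)) := by gcongr
        _ = Real.exp (x * 4) := by
          rw [← Real.exp_nat_mul]
          congr 1
          push_cast
          rw [hx]
          ring
    have h2 := convexOn_exp.2 (Set.mem_univ 0) (Set.mem_univ 4) (sub_nonneg.2 hx1) hx0 (by ring)
    simp only [smul_eq_mul, mul_zero, zero_add, Real.exp_zero, mul_one] at h2
    calc r ^ (2 * (i + 1)) / (i + 1 : ℝ) ≤ (1 + x * Real.exp 4) / (i + 1) := by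
          gcongr
          linarith
      _ = ((i + 1 : ℕ) : ℝ)⁻¹ + Real.exp 4 / N := by
          rw [hx]; push_cast; field_simp
  have h3 : ∑ i ∈ Finset.range N, r ^ (2 * (i + 1)) / (i + 1 : ℝ) ≤
      1 + Real.log N + Real.exp 4 := by
    refine (Finset.sum_le_sum key).trans ?_
    rw [Finset.sum_add_distrib]
    have := harmonic_le_one_add_log N
    have h4 : ∑ i ∈ Finset.range N, Real.exp 4 / (N : ℝ) = Real.exp 4 := by
      simp; field_simp
    rw [h4]
    simp only [harmonic, Rat.cast_sum, Rat.cast_inv, Rat.cast_natCast] at this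
    linarith
  calc _ ≤ Real.exp (1 + Real.log N + Real.exp 4) := Real.exp_le_exp.2 h3
    _ = _ := by
      rw [show 1 + Real.log N + Real.exp 4 = 1 + Real.exp 4 + Real.log N by ring, Real.exp_add,
        Real.exp_log hN0]

/-- The second moment of the random function on the circle of radius `‖z‖`. -/
theorem lintegral_norm_genF_sq_le {X : ℕ → Ω → ℂ} [IsProbabilityMeasure μ]
    (hXm : ∀ k, Measurable (X k)) (hX : IsStdComplexGaussianSeq X μ) {K : ℝ} (hK : 1 ≤ K) {z : ℂ}
    (hz : ‖z‖ ≤ Real.exp (2 / K)) :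
    ∫⁻ ω, ENNReal.ofReal (‖genF (fun k => X k ω) K z‖ ^ 2) ∂μ ≤
      ENNReal.ofReal (Real.exp (1 + Real.exp 4) * K) := by
  have hfl : 1 ≤ ⌊K⌋₊ := (Nat.one_le_floor_iff K).2 hK
  have hfl' : (0 : ℝ) < ⌊K⌋₊ := by exact_mod_cast hfl
  have hle : (⌊K⌋₊ : ℝ) ≤ K := Nat.floor_le (by linarith)
  simp only [norm_genF_sq]
  rw [lintegral_exp_two_mul_sum (measurable_termRe hXm z) (iIndepFun_termRe hX z)
    (map_termRe hX z)]
  refine ENNReal.ofReal_le_ofReal ((exp_two_mul_sum_termVar_le (norm_nonneg z) hfl ?_).trans ?_)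
  · exact hz.trans (by gcongr)
  · gcongr

/-! ### Dyadic blocks and the restricted second moment -/

/-- The times `0, 1, 2, 4, 8, …` at which the random walk is observed. -/
def dyadicTime : ℕ → ℕ
  | 0 => 0
  | n + 1 => 2 ^ n

theorem monotone_dyadicTime : Monotone dyadicTime := by
  refine monotone_nat_of_le_succ fun n => ?_
  cases n with
  | zero => simp [dyadicTime]
  | succ n => exact Nat.pow_le_pow_right (by norm_num) n.le_succ

/-- Block `n + 1` has `2 ^ n` terms, each at least `1 / (2 * 2 ^ (n + 1))`; block `0` is a single
term of size at least `1 / 2`. -/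
theorem block_termVar_ge {r : ℝ} (hr : 1 ≤ r) (n : ℕ) :
    (1 / 4 : ℝ) ≤ ((∑ j ∈ Finset.Ico (dyadicTime n) (dyadicTime (n + 1)), termVar r j : ℝ≥0) : ℝ) := by
  push_cast
  have h (j : ℕ) : 1 / (2 * (j + 1 : ℝ)) ≤ termVar r j := by
    rw [coe_termVar]
    gcongr
    exact one_le_pow₀ hr
  refine le_trans ?_ (Finset.sum_le_sum fun j _ => h j)
  cases n with
  | zero => simp [dyadicTime]; norm_num
  | succ n =>
    have h2 : ∑ j ∈ Finset.Ico (dyadicTime (n + 1)) (dyadicTime (n + 2)),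
        1 / (2 * (2 : ℝ) ^ (n + 1)) ≤
        ∑ j ∈ Finset.Ico (dyadicTime (n + 1)) (dyadicTime (n + 2)), 1 / (2 * (j + 1 : ℝ)) := by
      refine Finset.sum_le_sum fun j hj => ?_
      have : (j + 1 : ℝ) ≤ 2 ^ (n + 1) := by exact_mod_cast (Finset.mem_Ico.1 hj).2
      gcongr
    refine le_trans (le_of_eq ?_) h2
    simp only [dyadicTime, Finset.sum_const, Nat.card_Ico, nsmul_eq_mul]
    rw [show 2 ^ (n + 1) - 2 ^ n = 2 ^ n by rw [pow_succ]; omega]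
    push_cast
    rw [pow_succ]
    field_simp
    norm_num

theorem block_termVar_le {r K : ℝ} (hr : 0 ≤ r) (hK : 1 ≤ K) (hrK : r ≤ Real.exp (1 / K)) {n : ℕ}
    (hn : (2 : ℝ) ^ n ≤ K) :
    ((∑ j ∈ Finset.Ico (dyadicTime n) (dyadicTime (n + 1)), termVar r j : ℝ≥0) : ℝ) ≤
      Real.exp 2 := by
  push_cast
  have hK0 : 0 < K := by linarith
  have hpow (j : ℕ) (hj : (j + 1 : ℝ) ≤ 2 ^ n) : r ^ (2 * (j + 1)) ≤ Real.exp 2 := by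
    calc r ^ (2 * (j + 1)) ≤ Real.exp (1 / K) ^ (2 * (j + 1)) := by gcongr
      _ = Real.exp (2 * ((j + 1) / K)) := by
          rw [← Real.exp_nat_mul]
          congr 1
          push_cast
          ring
      _ ≤ Real.exp 2 := by
          rw [Real.exp_le_exp]
          have : (j + 1 : ℝ) / K ≤ 1 := by rw [div_le_one hK0]; linarith
          linarith
  have he := Real.exp_pos 2
  cases n with
  | zero =>
    simp only [dyadicTime, pow_zero, Nat.Ico_zero_eq_range, Finset.sum_range_one, coe_termVar]
    have := hpow 0 (by simp)
    refine (div_le_self (by positivity) (by norm_num)).trans this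
  | succ n =>
    have h2 : ∑ j ∈ Finset.Ico (dyadicTime (n + 1)) (dyadicTime (n + 2)), (termVar r j : ℝ) ≤
        ∑ j ∈ Finset.Ico (dyadicTime (n + 1)) (dyadicTime (n + 2)), Real.exp 2 / 2 ^ n := by
      refine Finset.sum_le_sum fun j hj => ?_
      have h3 : (j + 1 : ℝ) ≤ 2 ^ (n + 1) := by exact_mod_cast (Finset.mem_Ico.1 hj).2
      have h4 : (2 : ℝ) ^ n ≤ j := by exact_mod_cast (Finset.mem_Ico.1 hj).1
      rw [coe_termVar]
      gcongr
      · exact hpow j h3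
      · linarith
    refine h2.trans (le_of_eq ?_)
    simp only [dyadicTime, Finset.sum_const, Nat.card_Ico, nsmul_eq_mul]
    rw [show 2 ^ (n + 1) - 2 ^ n = 2 ^ n by rw [pow_succ]; omega]
    push_cast
    field_simp

/-- This is the drift produced by the tilt at scale `2 ^ n`. It absorbs the factor `4 ^ n` in the
pointwise bound, leaving a logarithmic barrier for the centred walk. -/
theorem mul_log_two_le_two_mul_sum_termVar {r : ℝ} (hr : 1 ≤ r) (n : ℕ) :
    n * Real.log 2 ≤ 2 * ∑ j ∈ Finset.range (2 ^ n), (termVar r j : ℝ) := by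
  rw [two_mul_sum_termVar]
  have h := log_add_one_le_harmonic (2 ^ n)
  simp only [harmonic, Rat.cast_sum, Rat.cast_inv, Rat.cast_natCast] at h
  calc n * Real.log 2 = Real.log (2 ^ n) := by rw [Real.log_pow]
    _ ≤ Real.log ((2 ^ n : ℕ) + 1) := by
        apply Real.log_le_log (by positivity)
        push_cast
        linarith
    _ ≤ ∑ i ∈ Finset.range (2 ^ n), (((i + 1 : ℕ) : ℝ))⁻¹ := by exact_mod_cast h
    _ ≤ _ := by
        refine Finset.sum_le_sum fun i _ => ?_
        rw [inv_eq_one_div]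
        push_cast
        gcongr
        exact one_le_pow₀ hr

/-- The second moment of the random function at a point, on the event that it is not too large
at the dyadic scales. -/
theorem exists_setLIntegral_norm_genF_sq_le : ∃ C : ℝ, 0 < C ∧
    ∀ {Ω : Type*} [MeasurableSpace Ω] {μ : Measure Ω} [IsProbabilityMeasure μ] {X : ℕ → Ω → ℂ},
      (∀ k, Measurable (X k)) → IsStdComplexGaussianSeq X μ →
      ∀ (K T : ℝ) (z : ℂ), 1 ≤ K → 1 ≤ T → 1 ≤ ‖z‖ → ‖z‖ ≤ Real.exp (1 / K) →
      ∀ s : Set Ω, (∀ ω ∈ s, ∀ n ≤ Nat.log 2 ⌊K⌋₊,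
        ‖genF (fun k => X k ω) (2 ^ n) z‖ ^ 2 ≤ T * 4 ^ n * (n + 1) ^ 2) →
      ∫⁻ ω in s, ENNReal.ofReal (‖genF (fun k => X k ω) K z‖ ^ 2) ∂μ ≤
        ENNReal.ofReal (C * K * (Real.log T + 1) / √(Nat.log 2 ⌊K⌋₊ + 1)) := by
  obtain ⟨C, hC, h⟩ := exists_survival_le (Real.exp 2)
  refine ⟨Real.exp (1 + Real.exp 4) * C, by positivity, ?_⟩
  intro Ω _ μ _ X hXm hX K T z hK hT hz1 hz2 s hs
  have hfl : 1 ≤ ⌊K⌋₊ := (Nat.one_le_floor_iff K).2 hK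
  have hfl' : (0 : ℝ) < ⌊K⌋₊ := by exact_mod_cast hfl
  have hle : (⌊K⌋₊ : ℝ) ≤ K := Nat.floor_le (by linarith)
  set L := Nat.log 2 ⌊K⌋₊ with hL
  have h2L : 2 ^ L ≤ ⌊K⌋₊ := Nat.pow_log_le_self 2 (by omega)
  -- Half the logarithm, because the squared modulus is `exp (2S)`.
  set a := Real.log T / 2 with ha
  have ha0 : 0 ≤ a := by have := Real.log_nonneg hT; positivity
  set A := {ω | ∀ i, 1 ≤ i → i ≤ L + 1 →
    ∑ j ∈ Finset.range (dyadicTime i), termRe (fun k => X k ω) z j ≤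
      (a + Real.log i) + 2 * ∑ j ∈ Finset.range (dyadicTime i), (termVar ‖z‖ j : ℝ)} with hA
  have hsA : s ⊆ A := by
    intro ω hω i hi1 hi2
    -- Scale `2 ^ n` is observed at time `n + 1`, so the factor `(n + 1) ^ 2` becomes exactly the
    -- `log i` of the barrier.
    obtain ⟨n, rfl⟩ : ∃ n, i = n + 1 := ⟨i - 1, by omega⟩
    have h1 := hs ω hω n (by omega)
    have hfn : ⌊(2 : ℝ) ^ n⌋₊ = 2 ^ n := by
      rw [show (2 : ℝ) ^ n = ((2 ^ n : ℕ) : ℝ) by push_cast; rfl, Nat.floor_natCast]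
    rw [norm_genF_sq, hfn, ← Real.le_log_iff_exp_le (by positivity),
      Real.log_mul (by positivity) (by positivity), Real.log_mul (by positivity) (by positivity),
      Real.log_pow, Real.log_pow, show (4 : ℝ) = 2 ^ 2 by norm_num, Real.log_pow] at h1
    have h2 := mul_log_two_le_two_mul_sum_termVar hz1 n
    simp only [dyadicTime]
    push_cast at h1 ⊢
    linarith
  refine (lintegral_mono_set hsA).trans ?_
  have h1 := setLIntegral_alive_exp_two_mul_sum (measurable_termRe hXm z) (iIndepFun_termRe hX z)
    (map_termRe hX z) monotone_dyadicTime rfl (fun m => a + Real.log m) (L + 1) h2L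
  have h2 := h (fun i => ∑ j ∈ Finset.Ico (dyadicTime i) (dyadicTime (i + 1)), termVar ‖z‖ j)
    (L + 1) (fun i _ => block_termVar_ge hz1 i)
    (fun i hi => block_termVar_le (norm_nonneg z) hK hz2 (by
      have : 2 ^ i ≤ ⌊K⌋₊ := (Nat.pow_le_pow_right (by norm_num) (by omega)).trans h2L
      calc (2 : ℝ) ^ i = ((2 ^ i : ℕ) : ℝ) := by push_cast; rfl
        _ ≤ ⌊K⌋₊ := by exact_mod_cast this
        _ ≤ K := hle)) a ha0
  simp only [norm_genF_sq]
  rw [h1, ← ENNReal.ofReal_mul (Real.exp_pos _).le]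
  refine ENNReal.ofReal_le_ofReal ?_
  have h3 := exp_two_mul_sum_termVar_le (norm_nonneg z) hfl (hz2.trans (by
    rw [Real.exp_le_exp]
    calc 1 / K ≤ 1 / ⌊K⌋₊ := by gcongr
      _ ≤ 2 / ⌊K⌋₊ := by gcongr; norm_num))
  have hsq : 0 < √((L + 1 : ℕ) : ℝ) := Real.sqrt_pos.2 (by positivity)
  have h4 : survival (fun i => ∑ j ∈ Finset.Ico (dyadicTime i) (dyadicTime (i + 1)), termVar ‖z‖ j)
      (fun m => a + Real.log m) (L + 1) ≤ C * (Real.log T + 1) / √((L + 1 : ℕ) : ℝ) := by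
    rw [le_div_iff₀ hsq, mul_comm]
    refine h2.trans ?_
    have := Real.log_nonneg hT
    gcongr
    linarith
  push_cast at h4
  calc _ ≤ Real.exp (1 + Real.exp 4) * K * (C * (Real.log T + 1) / √((L : ℝ) + 1)) := by
        refine mul_le_mul (h3.trans (by gcongr)) h4 (survival_nonneg _ _ _) (by positivity)
    _ = _ := by ring

end

/-! ### Pointwise control by mean squares -/

/-- Cauchy's formula bounds a value of an entire function by its mean on a larger circle. -/
theorem norm_le_mul_circle_mean {f : ℂ → ℂ} (hf : Differentiable ℂ f) {r R : ℝ} (hrR : r < R)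
    {z : ℂ} (hz : ‖z‖ ≤ r) :
    ‖f z‖ ≤ R / (R - r) *
      (1 / (2 * Real.pi) * ∫ θ in (0 : ℝ)..(2 * Real.pi), ‖f (circleMap 0 R θ)‖) := by
  have hR : 0 < R := (norm_nonneg z).trans_lt (hz.trans_lt hrR)
  have hd : 0 < R - r := sub_pos.2 hrR
  have hzb : z ∈ Metric.ball (0 : ℂ) R := by simpa using hz.trans_lt hrR
  have h := (hf.differentiableOn (s := Metric.closedBall 0 R)).circleIntegral_sub_inv_smul hzb
  have hpi : (0 : ℝ) < 2 * Real.pi := Real.two_pi_pos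
  have hn : ‖∮ w in C(0, R), (w - z)⁻¹ • f w‖ ≤
      ∫ θ in (0 : ℝ)..(2 * Real.pi), R / (R - r) * ‖f (circleMap 0 R θ)‖ := by
    rw [circleIntegral]
    refine intervalIntegral.norm_integral_le_of_norm_le hpi.le (.of_forall fun θ _ => ?_) ?_
    · simp only [deriv_circleMap, norm_smul, norm_mul, norm_inv, Complex.norm_I, mul_one,
        norm_circleMap_zero, abs_of_pos hR]
      have h1 : R - r ≤ ‖circleMap 0 R θ - z‖ := by
        have := norm_sub_norm_le (circleMap 0 R θ) z
        rw [norm_circleMap_zero, abs_of_pos hR] at this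
        linarith
      have h2 : ‖circleMap 0 R θ - z‖⁻¹ ≤ (R - r)⁻¹ := inv_anti₀ hd h1
      rw [div_eq_mul_inv, ← mul_assoc]
      gcongr
    · refine Continuous.intervalIntegrable ?_ _ _
      exact continuous_const.mul (hf.continuous.comp (continuous_circleMap 0 R)).norm
  rw [h, intervalIntegral.integral_const_mul, norm_smul] at hn
  have h3 : ‖(2 * Real.pi * Complex.I : ℂ)‖ = 2 * Real.pi := by
    simp [abs_of_pos Real.pi_pos]
  rw [h3] at hn
  rw [mul_left_comm, one_div, inv_mul_eq_div, le_div_iff₀ hpi]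
  linarith

theorem differentiable_genF (x : ℕ → ℂ) (K : ℝ) : Differentiable ℂ (genF x K) := by
  unfold genF
  fun_prop

theorem meanSq_nonneg (x : ℕ → ℂ) (K r : ℝ) : 0 ≤ meanSq x K r := by
  refine mul_nonneg (by positivity) (intervalIntegral.integral_nonneg Real.two_pi_pos.le ?_)
  intros; positivity

/-- Cauchy's formula is applied to the entire function `F²`. The circles of radii `exp (1 / K)` and
`exp (2 / K)` are at least `1 / K` apart, which costs the factor `K`. -/
theorem norm_genF_sq_le_meanSq (x : ℕ → ℂ) {K : ℝ} (hK : 1 ≤ K) {z : ℂ}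
    (hz : ‖z‖ ≤ Real.exp (1 / K)) :
    ‖genF x K z‖ ^ 2 ≤ Real.exp 2 * K * meanSq x K (Real.exp (2 / K)) := by
  have hK0 : 0 < K := by linarith
  have hgap : 1 / K ≤ Real.exp (2 / K) - Real.exp (1 / K) := by
    have h1 : Real.exp (2 / K) = Real.exp (1 / K) * Real.exp (1 / K) := by
      rw [← Real.exp_add]; ring_nf
    have h2 := Real.add_one_le_exp (1 / K)
    rw [h1]
    generalize Real.exp (1 / K) = e at h2 ⊢
    have h3 : 0 < 1 / K := by positivity
    generalize 1 / K = y at h2 h3 ⊢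
    nlinarith
  have hgap0 : 0 < 1 / K := by positivity
  have h := norm_le_mul_circle_mean ((differentiable_genF x K).pow 2)
    (sub_pos.1 (hgap0.trans_le hgap)) hz
  simp only [Pi.pow_apply, norm_pow] at h
  have e : 1 / (2 * Real.pi) *
      ∫ θ in (0 : ℝ)..(2 * Real.pi), ‖genF x K (circleMap 0 (Real.exp (2 / K)) θ)‖ ^ 2 =
      meanSq x K (Real.exp (2 / K)) := by
    simp only [meanSq, circleMap, zero_add, mul_comm]
  rw [e] at h
  refine h.trans (mul_le_mul_of_nonneg_right ?_ (meanSq_nonneg _ _ _))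
  rw [div_le_iff₀ (hgap0.trans_le hgap)]
  have h4 : Real.exp (2 / K) ≤ Real.exp 2 := by
    rw [Real.exp_le_exp]; exact div_le_self (by norm_num) hK
  calc Real.exp (2 / K) ≤ Real.exp 2 * K * (1 / K) := by
        rw [mul_assoc, mul_one_div_cancel hK0.ne', mul_one]; exact h4
    _ ≤ _ := by gcongr

theorem ofReal_meanSq (x : ℕ → ℂ) (K r : ℝ) :
    ENNReal.ofReal (meanSq x K r) = ENNReal.ofReal (1 / (2 * Real.pi)) *
      ∫⁻ θ in Set.Ioc 0 (2 * Real.pi),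
        ENNReal.ofReal (‖genF x K ((r : ℂ) * Complex.exp (Complex.I * (θ : ℂ)))‖ ^ 2) := by
  rw [meanSq, ENNReal.ofReal_mul (by positivity),
    intervalIntegral.integral_of_le Real.two_pi_pos.le, ofReal_integral_eq_lintegral_ofReal]
  · have hc : Continuous fun θ : ℝ =>
        ‖genF x K ((r : ℂ) * Complex.exp (Complex.I * (θ : ℂ)))‖ ^ 2 := by
      have := (differentiable_genF x K).continuous
      fun_prop
    exact hc.integrableOn_Ioc
  · exact .of_forall fun θ => by positivity

section

variable {Ω : Type*} [MeasurableSpace Ω] {μ : Measure Ω}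

theorem measurable_genF_prod {X : ℕ → Ω → ℂ} (hXm : ∀ k, Measurable (X k)) (K r : ℝ) :
    Measurable fun p : Ω × ℝ => ENNReal.ofReal
      (‖genF (fun k => X k p.1) K ((r : ℂ) * Complex.exp (Complex.I * (p.2 : ℂ)))‖ ^ 2) := by
  unfold genF
  fun_prop

theorem measurable_meanSq {X : ℕ → Ω → ℂ} (hXm : ∀ k, Measurable (X k)) (K r : ℝ) :
    Measurable fun ω => meanSq (fun k => X k ω) K r := by
  have h : Measurable fun ω => ENNReal.ofReal (meanSq (fun k => X k ω) K r) := by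
    simp only [ofReal_meanSq]
    exact (Measurable.lintegral_prod_right' (measurable_genF_prod hXm K r)).const_mul _
  simpa only [ENNReal.toReal_ofReal (meanSq_nonneg _ _ _)] using h.ennreal_toReal

/-- A uniform bound for the second moment on a circle bounds the expected mean square. -/
theorem lintegral_meanSq_le [SFinite μ] {X : ℕ → Ω → ℂ} (hXm : ∀ k, Measurable (X k)) {K r : ℝ}
    (hr : 0 ≤ r) {B : ℝ≥0∞} (h : ∀ z : ℂ, ‖z‖ = r →
      ∫⁻ ω, ENNReal.ofReal (‖genF (fun k => X k ω) K z‖ ^ 2) ∂μ ≤ B) :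
    ∫⁻ ω, ENNReal.ofReal (meanSq (fun k => X k ω) K r) ∂μ ≤ B := by
  have hz (θ : ℝ) : ‖(r : ℂ) * Complex.exp (Complex.I * (θ : ℂ))‖ = r := by
    rw [norm_mul, mul_comm Complex.I, Complex.norm_exp_ofReal_mul_I, mul_one, Complex.norm_real,
      Real.norm_of_nonneg hr]
  have hB : ∫⁻ _ in Set.Ioc 0 (2 * Real.pi), B = B * ENNReal.ofReal (2 * Real.pi) := by
    rw [setLIntegral_const, Real.volume_Ioc, sub_zero]
  have hpi : ENNReal.ofReal (1 / (2 * Real.pi)) * ENNReal.ofReal (2 * Real.pi) = 1 := by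
    rw [← ENNReal.ofReal_mul (by positivity), one_div, inv_mul_cancel₀ Real.two_pi_pos.ne',
      ENNReal.ofReal_one]
  simp only [ofReal_meanSq]
  rw [lintegral_const_mul _ (Measurable.lintegral_prod_right' (measurable_genF_prod hXm K r)),
    lintegral_lintegral_swap (measurable_genF_prod hXm K r).aemeasurable]
  refine (mul_le_mul_right (lintegral_mono fun θ => h _ (hz θ)) _).trans (le_of_eq ?_)
  rw [hB, mul_left_comm, hpi, mul_one]

/-- The sum over dyadic scales `2 ^ n`, `n ≤ L`, of the normalised mean squares. -/
noncomputable def scaleSum (x : ℕ → ℂ) (L : ℕ) : ℝ :=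
  ∑ n ∈ Finset.range (L + 1),
    meanSq x (2 ^ n) (Real.exp (2 / 2 ^ n)) / (2 ^ n * ((n : ℝ) + 1) ^ 2)

theorem scaleSum_nonneg (x : ℕ → ℂ) (L : ℕ) : 0 ≤ scaleSum x L :=
  Finset.sum_nonneg fun n _ => div_nonneg (meanSq_nonneg _ _ _) (by positivity)

/-- A sum of nonnegative terms dominates each of them. One factor `2 ^ n` is lost in Cauchy's
formula and another is the normalisation in `scaleSum`, whence `4 ^ n`. -/
theorem norm_genF_sq_le_scaleSum (x : ℕ → ℂ) {n L : ℕ} (hn : n ≤ L) {z : ℂ}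
    (hz : ‖z‖ ≤ Real.exp (1 / 2 ^ n)) :
    ‖genF x (2 ^ n) z‖ ^ 2 ≤ Real.exp 2 * scaleSum x L * 4 ^ n * (n + 1) ^ 2 := by
  refine (norm_genF_sq_le_meanSq x (one_le_pow₀ (by norm_num)) hz).trans ?_
  have h : meanSq x (2 ^ n) (Real.exp (2 / 2 ^ n)) / (2 ^ n * ((n : ℝ) + 1) ^ 2) ≤ scaleSum x L :=
    Finset.single_le_sum (f := fun n : ℕ =>
      meanSq x (2 ^ n) (Real.exp (2 / 2 ^ n)) / (2 ^ n * ((n : ℝ) + 1) ^ 2))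
      (fun m _ => div_nonneg (meanSq_nonneg _ _ _) (by positivity))
      (Finset.mem_range.2 (Nat.lt_succ_of_le hn))
  rw [div_le_iff₀ (by positivity)] at h
  calc _ ≤ Real.exp 2 * 2 ^ n * (scaleSum x L * (2 ^ n * ((n : ℝ) + 1) ^ 2)) := by gcongr
    _ = _ := by
      rw [show (4 : ℝ) = 2 * 2 by norm_num, mul_pow]
      ring

/-- The mean square at scale `2 ^ n` has expectation `O(2 ^ n)` even on the enlarged radius `exp (2
/ 2 ^ n)`, and the weights `1 / (n + 1) ^ 2` are summable. -/
theorem exists_lintegral_scaleSum_le : ∃ B : ℝ, 0 < B ∧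
    ∀ {Ω : Type*} [MeasurableSpace Ω] {μ : Measure Ω} [IsProbabilityMeasure μ] {X : ℕ → Ω → ℂ},
      (∀ k, Measurable (X k)) → IsStdComplexGaussianSeq X μ → ∀ L : ℕ,
      ∫⁻ ω, ENNReal.ofReal (scaleSum (fun k => X k ω) L) ∂μ ≤ ENNReal.ofReal B := by
  have hs : Summable fun n : ℕ => 1 / ((n : ℝ) + 1) ^ 2 := by
    have := (summable_nat_add_iff 1).2 (Real.summable_one_div_nat_pow.2 one_lt_two)
    simpa using this
  set E := Real.exp (1 + Real.exp 4) with hE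
  refine ⟨E * ∑' n : ℕ, 1 / ((n : ℝ) + 1) ^ 2, mul_pos (Real.exp_pos _)
    (hs.tsum_pos (fun n => by positivity) 0 (by norm_num)), ?_⟩
  intro Ω _ μ _ X hXm hX L
  have h1 (n : ℕ) : ∫⁻ ω, ENNReal.ofReal (meanSq (fun k => X k ω) (2 ^ n) (Real.exp (2 / 2 ^ n)) /
      (2 ^ n * ((n : ℝ) + 1) ^ 2)) ∂μ ≤ ENNReal.ofReal (E * (1 / ((n : ℝ) + 1) ^ 2)) := by
    have h2 := lintegral_meanSq_le (μ := μ) hXm (K := 2 ^ n) (r := Real.exp (2 / 2 ^ n))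
      (Real.exp_pos _).le fun z hz =>
        lintegral_norm_genF_sq_le hXm hX (one_le_pow₀ (by norm_num)) hz.le
    have hm : Measurable fun ω => ENNReal.ofReal (meanSq (fun k => X k ω) (2 ^ n)
        (Real.exp (2 / 2 ^ n))) := (measurable_meanSq hXm _ _).ennreal_ofReal
    simp only [div_eq_mul_inv, ENNReal.ofReal_mul (meanSq_nonneg _ _ _)]
    simp only [div_eq_mul_inv] at h2 hm
    rw [lintegral_mul_const _ hm]
    refine (mul_le_mul_left h2 _).trans ?_
    rw [← ENNReal.ofReal_mul (by positivity)]
    refine ENNReal.ofReal_le_ofReal (le_of_eq ?_)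
    rw [← hE]
    field_simp
  have hnn (ω : Ω) (n : ℕ) (_ : n ∈ Finset.range (L + 1)) :
      0 ≤ meanSq (fun k => X k ω) (2 ^ n) (Real.exp (2 / 2 ^ n)) / (2 ^ n * ((n : ℝ) + 1) ^ 2) :=
    div_nonneg (meanSq_nonneg _ _ _) (by positivity)
  simp only [scaleSum, fun ω => ENNReal.ofReal_sum_of_nonneg (hnn ω)]
  rw [lintegral_finsetSum _ fun n _ => ((measurable_meanSq hXm _ _).div_const _).ennreal_ofReal]
  refine (Finset.sum_le_sum fun n _ => h1 n).trans ?_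
  rw [← ENNReal.ofReal_sum_of_nonneg fun n _ => by positivity, ← Finset.mul_sum]
  refine ENNReal.ofReal_le_ofReal ?_
  gcongr
  exact hs.sum_le_tsum _ fun n _ => by positivity

/-! ### Interpolation of moments -/

theorem lintegral_rpow_le_rpow_lintegral [IsProbabilityMeasure μ] {f : Ω → ℝ≥0∞}
    (hf : Measurable f) {q : ℝ} (hq0 : 0 ≤ q) (hq1 : q ≤ 1) :
    ∫⁻ ω, f ω ^ q ∂μ ≤ (∫⁻ ω, f ω ∂μ) ^ q := by
  have := ENNReal.lintegral_mul_norm_pow_le (μ := μ) hf.aemeasurable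
    (aemeasurable_const (b := (1 : ℝ≥0∞))) hq0 (sub_nonneg.2 hq1) (by ring)
  simpa using this

theorem hasSum_succ_mul_geometric {x : ℝ} (hx0 : 0 ≤ x) (hx1 : x < 1) :
    HasSum (fun j : ℕ => (1 - x) * x ^ j * (j + 1)) (1 / (1 - x)) := by
  have hx : ‖x‖ < 1 := by rwa [Real.norm_of_nonneg hx0]
  have h := ((hasSum_coe_mul_geometric_of_norm_lt_one hx).add
    (hasSum_geometric_of_norm_lt_one hx)).mul_left (1 - x)
  have h1 : 1 - x ≠ 0 := by linarith
  have h2 : (1 - x) * (x / (1 - x) ^ 2 + (1 - x)⁻¹) = 1 / (1 - x) := by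
    field_simp
    ring
  rw [h2] at h
  have h3 : (fun j : ℕ => (1 - x) * x ^ j * (j + 1)) = fun j : ℕ =>
      (1 - x) * (j * x ^ j + x ^ j) := by ext j; ring
  rwa [h3]

/-- Interpolation: moments of order `1 - δ` of `M` are controlled by the means of `M` over the
sublevel sets of an integrable function `W`, if these grow slowly. -/
theorem lintegral_rpow_le_of_setLIntegral_le [IsProbabilityMeasure μ] {M W : Ω → ℝ}
    (hM : Measurable M) (hW : Measurable W) (hW0 : ∀ ω, 0 ≤ W ω)
    {A B δ : ℝ} (hA : 0 ≤ A) (hB : 0 ≤ B) (hδ0 : 0 < δ) (hδ1 : δ ≤ 1)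
    (hWB : ∫⁻ ω, ENNReal.ofReal (W ω) ∂μ ≤ ENNReal.ofReal B)
    (hMA : ∀ j : ℕ, ∫⁻ ω in {ω | W ω ≤ Real.exp j}, ENNReal.ofReal (M ω) ∂μ ≤
      ENNReal.ofReal (A * (j + 1))) :
    ∫⁻ ω, ENNReal.ofReal (M ω) ^ (1 - δ) ∂μ ≤
      ENNReal.ofReal ((2 * A / δ) ^ (1 - δ) * (Real.exp 1 * (1 + B)) ^ δ) := by
  set x := Real.exp (-δ) with hx
  have hx0 : 0 < x := Real.exp_pos _
  have hx1 : x < 1 := by rw [hx, ← Real.exp_zero, Real.exp_lt_exp]; linarith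
  have hxδ : δ / 2 ≤ 1 - x := by
    have h1 : x ≤ 1 / (1 + δ) := by
      rw [hx, Real.exp_neg, ← one_div]
      exact one_div_le_one_div_of_le (by linarith) (by linarith [Real.add_one_le_exp δ])
    have h2 : δ / 2 ≤ 1 - 1 / (1 + δ) := by
      rw [show 1 - 1 / (1 + δ) = δ / (1 + δ) by field_simp; ring]
      gcongr
      linarith
    linarith
  have hsm (j : ℕ) : MeasurableSet {ω | W ω ≤ Real.exp j} := hW measurableSet_Iic
  -- `Z` is a geometric average of the sublevel indicators, of size about `(1 + W) ^ (-δ)`. It is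
  -- small enough for `M * Z` to have mean at most `2A / δ`, and large enough for `g ^ δ` to
  -- compensate.
  set Z : Ω → ℝ≥0∞ := fun ω => ∑' j : ℕ, ENNReal.ofReal ((1 - x) * x ^ j) *
    {ω | W ω ≤ Real.exp j}.indicator 1 ω with hZ
  set g : Ω → ℝ≥0∞ := fun ω => ENNReal.ofReal (Real.exp 1 * (1 + W ω)) with hg
  have hgm : Measurable g := by fun_prop
  have hZm : Measurable Z := Measurable.tsum fun j =>
    (measurable_one.indicator (hsm j)).const_mul _
  have hZg (ω : Ω) : 1 ≤ Z ω * g ω ^ δ := by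
    -- All sublevel sets of index at least `J` contain `ω`, so `Z ω ≥ x ^ J = exp (-δ J)`. The
    -- factor `exp 1` in `g` pays for the rounding in `J`.
    set J := ⌈Real.log (1 + W ω)⌉₊ with hJ
    have hW1 : 0 < 1 + W ω := by linarith [hW0 ω]
    have h1 : ENNReal.ofReal (x ^ J) ≤ Z ω := by
      have h2 : ∀ j : ℕ, ENNReal.ofReal ((1 - x) * x ^ (j + J)) =
          ENNReal.ofReal ((1 - x) * x ^ (j + J)) *
            {ω | W ω ≤ Real.exp ((j + J : ℕ) : ℝ)}.indicator 1 ω := by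
        intro j
        have hmem : ω ∈ {ω | W ω ≤ Real.exp ((j + J : ℕ) : ℝ)} := by
          have h3 : Real.log (1 + W ω) ≤ ((j + J : ℕ) : ℝ) :=
            (Nat.le_ceil _).trans (by push_cast; linarith [Nat.cast_nonneg (α := ℝ) j])
          have h4 := (Real.log_le_iff_le_exp hW1).1 h3
          simp only [Set.mem_ofPred_eq]
          linarith
        rw [Set.indicator_of_mem hmem, Pi.one_apply, mul_one]
      have h3 : ∑' j : ℕ, ENNReal.ofReal ((1 - x) * x ^ (j + J)) ≤ Z ω := by
        rw [tsum_congr h2]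
        exact ENNReal.tsum_comp_le_tsum_of_injective (add_left_injective J)
          (fun j : ℕ => ENNReal.ofReal ((1 - x) * x ^ j) *
            {ω | W ω ≤ Real.exp j}.indicator 1 ω)
      refine le_of_eq_of_le ?_ h3
      have hsum : HasSum (fun j : ℕ => (1 - x) * x ^ (j + J)) (x ^ J) := by
        have := (hasSum_geometric_of_lt_one hx0.le hx1).mul_left ((1 - x) * x ^ J)
        rw [mul_right_comm, mul_inv_cancel₀ (by linarith), one_mul] at this
        have e : (fun j : ℕ => (1 - x) * x ^ (j + J)) = fun j => (1 - x) * x ^ J * x ^ j := by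
          ext j; ring
        rwa [e]
      rw [← hsum.tsum_eq, ENNReal.ofReal_tsum_of_nonneg (fun j => mul_nonneg (by linarith)
        (by positivity)) hsum.summable]
    refine le_trans ?_ (mul_le_mul_left h1 _)
    rw [hg, ENNReal.ofReal_rpow_of_nonneg (by positivity) hδ0.le,
      ← ENNReal.ofReal_mul (by positivity), ENNReal.one_le_ofReal,
      Real.rpow_def_of_pos (by positivity), Real.log_mul (Real.exp_pos _).ne' hW1.ne', Real.log_exp,
      hx, ← Real.exp_nat_mul, ← Real.exp_add, Real.one_le_exp_iff]
    have := Nat.ceil_lt_add_one (Real.log_nonneg (by linarith [hW0 ω] : 1 ≤ 1 + W ω))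
    rw [← hJ] at this
    nlinarith
  have hpoint (ω : Ω) : ENNReal.ofReal (M ω) ^ (1 - δ) ≤
      (ENNReal.ofReal (M ω) * Z ω) ^ (1 - δ) * g ω ^ δ := by
    have hg1 : 1 ≤ g ω := by
      rw [hg, ENNReal.one_le_ofReal]
      nlinarith [hW0 ω, Real.add_one_le_exp 1]
    -- When `Z ω ≤ 1`, lowering the exponent to `1 - δ` only increases the power, and `hZg` applies;
    -- otherwise both factors are at least `1`.
    have h1 : 1 ≤ Z ω ^ (1 - δ) * g ω ^ δ := by
      rcases le_total 1 (Z ω) with h | h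
      · have h2 := ENNReal.rpow_le_rpow h (by linarith : 0 ≤ 1 - δ)
        have h3 := ENNReal.rpow_le_rpow hg1 hδ0.le
        rw [ENNReal.one_rpow] at h2 h3
        exact one_le_mul h2 h3
      · refine (hZg ω).trans (mul_le_mul_left ?_ _)
        have := ENNReal.rpow_le_rpow_of_exponent_ge h (by linarith : 1 - δ ≤ 1)
        rwa [ENNReal.rpow_one] at this
    rw [ENNReal.mul_rpow_of_nonneg _ _ (by linarith : 0 ≤ 1 - δ), mul_assoc]
    exact le_mul_of_one_le_right' h1
  have hMZ : ∫⁻ ω, ENNReal.ofReal (M ω) * Z ω ∂μ ≤ ENNReal.ofReal (2 * A / δ) := by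
    have e1 (ω : Ω) : ENNReal.ofReal (M ω) * Z ω = ∑' j : ℕ, ENNReal.ofReal ((1 - x) * x ^ j) *
        {ω | W ω ≤ Real.exp j}.indicator (fun ω => ENNReal.ofReal (M ω)) ω := by
      rw [hZ, ← ENNReal.tsum_mul_left]
      refine tsum_congr fun j => ?_
      by_cases h : ω ∈ {ω | W ω ≤ Real.exp j}
      · rw [Set.indicator_of_mem h, Set.indicator_of_mem h, Pi.one_apply, mul_one, mul_comm]
      · rw [Set.indicator_of_notMem h, Set.indicator_of_notMem h]; simp
    simp only [e1]
    rw [lintegral_tsum fun j =>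
      ((hM.ennreal_ofReal.indicator (hsm j)).const_mul _).aemeasurable]
    have hsum := (hasSum_succ_mul_geometric hx0.le hx1).mul_left A
    calc _ ≤ ∑' j : ℕ, ENNReal.ofReal (A * ((1 - x) * x ^ j * (j + 1))) := by
          refine ENNReal.tsum_le_tsum fun j => ?_
          rw [lintegral_const_mul _ (hM.ennreal_ofReal.indicator (hsm j)),
            lintegral_indicator (hsm j)]
          refine (mul_le_mul_right (hMA j) _).trans (le_of_eq ?_)
          rw [← ENNReal.ofReal_mul (mul_nonneg (by linarith) (by positivity))]
          congr 1
          ring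
      _ = ENNReal.ofReal (A * (1 / (1 - x))) := by
          rw [← hsum.tsum_eq, ENNReal.ofReal_tsum_of_nonneg (fun j => mul_nonneg hA
            (mul_nonneg (mul_nonneg (by linarith) (by positivity)) (by positivity))) hsum.summable]
      _ ≤ ENNReal.ofReal (2 * A / δ) := by
          refine ENNReal.ofReal_le_ofReal ?_
          rw [show 2 * A / δ = A * (1 / (δ / 2)) by field_simp]
          gcongr
  have hgB : ∫⁻ ω, g ω ∂μ ≤ ENNReal.ofReal (Real.exp 1 * (1 + B)) := by
    simp only [hg, ENNReal.ofReal_mul (Real.exp_pos _).le,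
      fun ω => ENNReal.ofReal_add zero_le_one (hW0 ω)]
    rw [lintegral_const_mul _ (by fun_prop), lintegral_add_left (by fun_prop),
      ENNReal.ofReal_add zero_le_one hB]
    gcongr
    simp
  calc ∫⁻ ω, ENNReal.ofReal (M ω) ^ (1 - δ) ∂μ ≤
      ∫⁻ ω, (ENNReal.ofReal (M ω) * Z ω) ^ (1 - δ) * g ω ^ δ ∂μ := lintegral_mono hpoint
    _ ≤ (∫⁻ ω, ENNReal.ofReal (M ω) * Z ω ∂μ) ^ (1 - δ) * (∫⁻ ω, g ω ∂μ) ^ δ :=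
        ENNReal.lintegral_mul_norm_pow_le (hM.ennreal_ofReal.mul hZm).aemeasurable
          hgm.aemeasurable (by linarith) hδ0.le (by ring)
    _ ≤ ENNReal.ofReal (2 * A / δ) ^ (1 - δ) * ENNReal.ofReal (Real.exp 1 * (1 + B)) ^ δ := by
        gcongr
    _ = _ := by
        rw [ENNReal.ofReal_rpow_of_nonneg (by positivity) (by linarith),
          ENNReal.ofReal_rpow_of_nonneg (by positivity) hδ0.le, ← ENNReal.ofReal_mul (by positivity)]

end

/-! ### Assembly of the moment bound -/

theorem log_le_log_two_floor_add_one {K : ℝ} (hK : 1 ≤ K) :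
    Real.log K ≤ Nat.log 2 ⌊K⌋₊ + 1 := by
  have h1 : K < 2 ^ (Nat.log 2 ⌊K⌋₊ + 1) := by
    have h2 : ⌊K⌋₊ + 1 ≤ 2 ^ (Nat.log 2 ⌊K⌋₊ + 1) := Nat.lt_pow_succ_log_self (by norm_num) _
    have h3 : ((⌊K⌋₊ + 1 : ℕ) : ℝ) ≤ ((2 ^ (Nat.log 2 ⌊K⌋₊ + 1) : ℕ) : ℝ) := by exact_mod_cast h2
    push_cast at h3
    exact (Nat.lt_floor_add_one K).trans_le h3
  have h4 := Real.log_le_log (by linarith) h1.le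
  rw [Real.log_pow] at h4
  push_cast at h4
  have := Real.log_two_lt_d9
  have : (0 : ℝ) ≤ (Nat.log 2 ⌊K⌋₊ : ℝ) := Nat.cast_nonneg _
  nlinarith

theorem exists_lintegral_meanSq_rpow_le : ∃ C : ℝ, 0 < C ∧
    ∀ {Ω : Type*} [MeasurableSpace Ω] {μ : Measure Ω} [IsProbabilityMeasure μ] {X : ℕ → Ω → ℂ},
      (∀ k, Measurable (X k)) → IsStdComplexGaussianSeq X μ →
      ∀ K q r : ℝ, 1 ≤ K → 0 ≤ q → q ≤ 1 → 1 ≤ r → r ≤ Real.exp (1 / K) →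
      ∫⁻ ω, ENNReal.ofReal (meanSq (fun k => X k ω) K r) ^ q ∂μ ≤
        ENNReal.ofReal (C * (K / ((1 - q) * √(Real.log K) + 1)) ^ q) := by
  obtain ⟨C₁, hC₁, hgood⟩ := exists_setLIntegral_norm_genF_sq_le
  obtain ⟨B, hB, hscale⟩ := exists_lintegral_scaleSum_le
  set E := Real.exp (1 + Real.exp 4) with hE
  have hE0 : 0 < E := Real.exp_pos _
  refine ⟨(2 * E + 1) + (12 * C₁ + 1) * (Real.exp 1 * (1 + B)), by positivity, ?_⟩
  intro Ω _ μ _ X hXm hX K q r hK hq0 hq1 hr1 hrK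
  have hK0 : 0 < K := by linarith
  have hr0 : 0 ≤ r := by linarith
  have hMm := measurable_meanSq hXm K r
  have hlog : 0 ≤ Real.log K := Real.log_nonneg hK
  set Q := √(Real.log K) with hQ
  have hQ0 : 0 ≤ Q := Real.sqrt_nonneg _
  have hδQ : 0 ≤ (1 - q) * Q := mul_nonneg (by linarith) hQ0
  have rpow_le (c : ℝ) (hc : 0 ≤ c) : c ^ q ≤ c + 1 := by
    calc c ^ q ≤ (c + 1) ^ q := by gcongr; linarith
      _ ≤ (c + 1) ^ (1 : ℝ) := Real.rpow_le_rpow_of_exponent_le (by linarith) hq1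
      _ = c + 1 := Real.rpow_one _
  have hb0 : 0 ≤ K / ((1 - q) * Q + 1) := by positivity
  have hexp : 1 ≤ Real.exp 1 * (1 + B) := by nlinarith [Real.add_one_le_exp 1]
  -- If `(1 - q) * Q ≤ 1`, the denominator is at most `2` and the first moment suffices. Otherwise
  -- `q < 1` and the barrier argument gives the saving.
  rcases le_or_gt ((1 - q) * Q) 1 with hle | hgt
  · have h1 : ∫⁻ ω, ENNReal.ofReal (meanSq (fun k => X k ω) K r) ∂μ ≤ ENNReal.ofReal (E * K) :=
      lintegral_meanSq_le hXm hr0 fun z hz => lintegral_norm_genF_sq_le hXm hX hK (by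
        rw [hz]; exact hrK.trans (by gcongr; norm_num))
    refine (lintegral_rpow_le_rpow_lintegral hMm.ennreal_ofReal hq0 hq1).trans ?_
    refine (ENNReal.rpow_le_rpow h1 hq0).trans ?_
    rw [ENNReal.ofReal_rpow_of_nonneg (by positivity) hq0]
    refine ENNReal.ofReal_le_ofReal ?_
    have h2 : E * K ≤ 2 * E * (K / ((1 - q) * Q + 1)) := by
      rw [mul_div_assoc', le_div_iff₀ (by positivity)]
      have : 0 < E * K := by positivity
      nlinarith
    calc (E * K) ^ q ≤ (2 * E * (K / ((1 - q) * Q + 1))) ^ q := by gcongr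
      _ = (2 * E) ^ q * (K / ((1 - q) * Q + 1)) ^ q := Real.mul_rpow (by positivity) hb0
      _ ≤ _ := by
        gcongr
        refine (rpow_le _ (by positivity)).trans ?_
        have : 0 ≤ (12 * C₁ + 1) * (Real.exp 1 * (1 + B)) := by positivity
        linarith
  · set δ := 1 - q with hδ
    have hδ0 : 0 < δ := by
      rcases (by linarith : 0 ≤ δ).eq_or_lt with h | h
      · rw [← h] at hgt; simp at hgt; linarith
      · exact h
    have hQpos : 0 < Q := by
      rcases hQ0.eq_or_lt with h | h
      · rw [← h] at hgt; simp at hgt; linarith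
      · exact h
    set L := Nat.log 2 ⌊K⌋₊ with hL
    have h2L : (2 : ℝ) ^ L ≤ K := by
      have : 2 ^ L ≤ ⌊K⌋₊ :=
        Nat.pow_log_le_self 2 (by have := (Nat.one_le_floor_iff K).2 hK; omega)
      calc (2 : ℝ) ^ L = ((2 ^ L : ℕ) : ℝ) := by push_cast; rfl
        _ ≤ ⌊K⌋₊ := by exact_mod_cast this
        _ ≤ K := Nat.floor_le hK0.le
    have hQL : Q ≤ √((L : ℝ) + 1) := Real.sqrt_le_sqrt (log_le_log_two_floor_add_one hK)
    have hWm : Measurable fun ω => scaleSum (fun k => X k ω) L :=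
      Finset.measurable_sum _ fun n _ => (measurable_meanSq hXm _ _).div_const _
    have hMA (j : ℕ) : ∫⁻ ω in {ω | scaleSum (fun k => X k ω) L ≤ Real.exp j},
        ENNReal.ofReal (meanSq (fun k => X k ω) K r) ∂μ ≤
        ENNReal.ofReal (3 * C₁ * K / Q * (j + 1)) := by
      refine lintegral_meanSq_le hXm hr0 fun z hz => ?_
      -- In `T`, the factor `exp 2` comes from Cauchy's formula and `exp j` from the level of
      -- `scaleSum`. Then `log T + 1 = j + 3 ≤ 3 (j + 1)`.
      refine (hgood hXm hX K (Real.exp (2 + j)) z hK (Real.one_le_exp (by positivity))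
        (by rw [hz]; exact hr1) (by rw [hz]; exact hrK) _ fun ω hω n hn => ?_).trans ?_
      · have h2n : (2 : ℝ) ^ n ≤ K := (pow_le_pow_right₀ (by norm_num) hn).trans h2L
        refine (norm_genF_sq_le_scaleSum (fun k => X k ω) hn ?_).trans ?_
        · rw [hz]
          exact hrK.trans (by gcongr)
        · rw [Real.exp_add]
          have : scaleSum (fun k => X k ω) L ≤ Real.exp j := hω
          gcongr
      · refine ENNReal.ofReal_le_ofReal ?_
        rw [Real.log_exp]
        calc C₁ * K * (2 + j + 1) / √((L : ℝ) + 1) ≤ C₁ * K * (3 * (j + 1)) / Q := by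
              gcongr
              linarith [Nat.cast_nonneg (α := ℝ) j]
          _ = _ := by ring
    have hmain := lintegral_rpow_le_of_setLIntegral_le hMm hWm (fun ω => scaleSum_nonneg _ _)
      (A := 3 * C₁ * K / Q) (by positivity) hB.le hδ0 (by linarith) (hscale hXm hX L) hMA
    rw [show 1 - δ = q by rw [hδ]; ring] at hmain
    refine hmain.trans (ENNReal.ofReal_le_ofReal ?_)
    -- Since `δ * Q > 1`, the denominator `δ * Q + 1` is at most `2 * δ * Q`, which doubles the
    -- constant `6`.
    have h2 : 2 * (3 * C₁ * K / Q) / δ ≤ 12 * C₁ * (K / (δ * Q + 1)) := by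
      rw [mul_div_assoc', div_le_iff₀ hδ0, mul_div_assoc', div_mul_eq_mul_div,
        div_le_div_iff₀ hQpos (by positivity)]
      have : 0 < C₁ * K := by positivity
      nlinarith
    have h3 : (Real.exp 1 * (1 + B)) ^ δ ≤ Real.exp 1 * (1 + B) := by
      calc _ ≤ (Real.exp 1 * (1 + B)) ^ (1 : ℝ) :=
            Real.rpow_le_rpow_of_exponent_le hexp (by linarith)
        _ = _ := Real.rpow_one _
    calc (2 * (3 * C₁ * K / Q) / δ) ^ q * (Real.exp 1 * (1 + B)) ^ δ ≤
        (12 * C₁ * (K / (δ * Q + 1))) ^ q * (Real.exp 1 * (1 + B)) := by gcongr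
      _ = (12 * C₁) ^ q * (K / (δ * Q + 1)) ^ q * (Real.exp 1 * (1 + B)) := by
          rw [Real.mul_rpow (by positivity) hb0]
      _ ≤ (12 * C₁ + 1) * (K / (δ * Q + 1)) ^ q * (Real.exp 1 * (1 + B)) := by
          gcongr
          exact rpow_le _ (by positivity)
      _ = (12 * C₁ + 1) * (Real.exp 1 * (1 + B)) * (K / (δ * Q + 1)) ^ q := by ring
      _ ≤ _ := by
          gcongr
          linarith

theorem meanSq_congr {x y : ℕ → ℂ} (h : ∀ k, 1 ≤ k → x k = y k) (K r : ℝ) :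
    meanSq x K r = meanSq y K r := by
  have hF (z : ℂ) : genF x K z = genF y K z := by
    unfold genF
    congr 1
    exact Finset.sum_congr rfl fun k hk => by rw [h k (Finset.mem_Icc.1 hk).1]
  simp only [meanSq, hF]

/-- The variables may be replaced by genuinely measurable ones. -/
theorem IsStdComplexGaussianSeq.exists_measurable {Ω : Type*} [MeasurableSpace Ω] {μ : Measure Ω}
    {X : ℕ → Ω → ℂ} (hX : IsStdComplexGaussianSeq X μ) :
    ∃ Y : ℕ → Ω → ℂ, (∀ k, Measurable (Y k)) ∧ IsStdComplexGaussianSeq Y μ ∧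
      ∀ᵐ ω ∂μ, ∀ k, 1 ≤ k → X k ω = Y k ω := by
  have h (k : ℕ) : ∃ Y : Ω → ℂ, Measurable Y ∧ (1 ≤ k → X k =ᵐ[μ] Y) := by
    by_cases hk : 1 ≤ k
    · obtain ⟨Y, hY, hXY⟩ := (hX.hasLaw k hk).aemeasurable
      exact ⟨Y, hY, fun _ => hXY⟩
    · exact ⟨0, measurable_zero, fun h => absurd h hk⟩
  choose Y hYm hXY using h
  refine ⟨Y, hYm, ⟨fun k hk => (hX.hasLaw k hk).congr (hXY k hk).symm,
    hX.indep.congr fun k => hXY k k.2⟩, ?_⟩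
  rw [ae_all_iff]
  intro k
  by_cases hk : 1 ≤ k
  · filter_upwards [hXY k hk] with ω hω _ using hω
  · exact .of_forall fun ω h => absurd h hk

theorem proposition3p2 :
    ∃ C : ℝ, 0 < C ∧
      ∀ (Ω : Type*) [MeasurableSpace Ω] (μ : Measure Ω) [IsProbabilityMeasure μ]
        (X : ℕ → Ω → ℂ), IsStdComplexGaussianSeq X μ →
      ∀ K q r : ℝ, 1 ≤ K → 1 / 2 ≤ q → q ≤ 1 → 1 ≤ r → r ≤ Real.exp (1 / K) →
        Integrable (fun ω => (meanSq (fun k => X k ω) K r) ^ q) μ ∧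
        ∫ ω, (meanSq (fun k => X k ω) K r) ^ q ∂μ
          ≤ C * (K / ((1 - q) * Real.sqrt (Real.log K) + 1)) ^ q := by
  obtain ⟨C, hC, h⟩ := exists_lintegral_meanSq_rpow_le
  refine ⟨C, hC, fun Ω _ μ _ X hX K q r hK hq hq1 hr hrK => ?_⟩
  obtain ⟨Y, hYm, hY, hXY⟩ := hX.exists_measurable
  have hae : (fun ω => (meanSq (fun k => X k ω) K r) ^ q) =ᵐ[μ]
      fun ω => (meanSq (fun k => Y k ω) K r) ^ q := by
    filter_upwards [hXY] with ω hω
    rw [meanSq_congr hω]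
  have hq0 : 0 ≤ q := by linarith
  have hm : Measurable fun ω => (meanSq (fun k => Y k ω) K r) ^ q :=
    (measurable_meanSq hYm K r).pow_const q
  have hnn (ω : Ω) : 0 ≤ (meanSq (fun k => Y k ω) K r) ^ q :=
    Real.rpow_nonneg (meanSq_nonneg _ _ _) q
  have hbound : ∫⁻ ω, ENNReal.ofReal ((meanSq (fun k => Y k ω) K r) ^ q) ∂μ ≤
      ENNReal.ofReal (C * (K / ((1 - q) * Real.sqrt (Real.log K) + 1)) ^ q) := by
    refine le_of_eq_of_le (lintegral_congr fun ω => ?_) (h hYm hY K q r hK hq0 hq1 hr hrK)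
    rw [ENNReal.ofReal_rpow_of_nonneg (meanSq_nonneg _ _ _) hq0]
  have hrhs : 0 ≤ C * (K / ((1 - q) * Real.sqrt (Real.log K) + 1)) ^ q := by
    have : 0 ≤ 1 - q := by linarith
    positivity
  constructor
  · refine Integrable.congr ⟨hm.aestronglyMeasurable, ?_⟩ hae.symm
    rw [hasFiniteIntegral_iff_ofReal (.of_forall hnn)]
    exact hbound.trans_lt ENNReal.ofReal_lt_top
  · rw [integral_congr_ae hae, integral_eq_lintegral_of_nonneg_ae (.of_forall hnn)
      hm.aestronglyMeasurable]
    exact ENNReal.toReal_le_of_le_ofReal hrhs hbound
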